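/- Let $H_7$ be the genus-2 hyperelliptic curve $$v^2=u\left(1-\tfrac{63}{4}u+91u^2-231u^3+224u^4\right),$$ and on $H_7$ put $$P_7=v+\tfrac72u-35u^2+112u^3-128u^4,\qquad \Psi_7=\frac{P_7^{2}\,(2v-3u+14u^2)^7}{u\,(1-4u)^7\,(-2v-3u+14u^2)^7},$$ $$P_1=1344u^5-1540u^4+784u^3-204u^2+\tfrac{53}{2}u-\tfrac{11}{8}-3(28u^2-10u+1)v,$$ $$Q_1=-112u^4+84u^3-25u^2+\tfrac52u+(16u^2-4u+1)v.$$ Consider the four (multivalued) analytic functions on $H_7$ $$W_7=\sqrt{2v+3u-14u^2}\;P_7^{1/14}\,u^{-2/7}\; {}_3F_2\!\left(\begin{matrix}-\frac1{14},\frac1{14},\frac5{14}\\ \frac17,\frac57\end{matrix}\,\Big|\,\Psi_7\right), \qquad W_0=4u-1,$$ $$W_{\pm}=\left(P_1\pm Q_1\sqrt{56u-21+\tfrac2u}\,\right)^{1/4},$$ where $W_7$ is defined by the hypergeometric series where $|\Psi_7|<1$, and by analytic continuation elsewhere. Then these four functions satisfy the same linear differential equation of order $3$ with coefficients in the function field of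 $H_7$: there are polynomials $c_0,c_1,c_2,c_3\in\mathbb{C}[u,v]$, with $c_3$ not identically zero on $H_7$, such that $$c_3\,\frac{d^3W}{du^3}+c_2\,\frac{d^2W}{du^2}+c_1\,\frac{dW}{du}+c_0\,W=0$$ holds on $H_7$ for every branch $W$ of each of $W_7,W_0,W_+,W_-$. -/

import Mathlib

/-- The generalized hypergeometric series
`₃F₂(a₁, a₂, a₃; b₁, b₂ | z) = ∑ₙ (a₁)ₙ (a₂)ₙ (a₃)ₙ / ((b₁)ₙ (b₂)ₙ n!) zⁿ`, meant for `‖z‖ < 1`. -/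
noncomputable def hyp3F2 (a₁ a₂ a₃ b₁ b₂ z : ℂ) : ℂ :=
  ∑' n : ℕ, ((ascPochhammer ℂ n).eval a₁ * (ascPochhammer ℂ n).eval a₂ *
      (ascPochhammer ℂ n).eval a₃) /
    ((ascPochhammer ℂ n).eval b₁ * (ascPochhammer ℂ n).eval b₂ * (Nat.factorial n : ℂ)) * z ^ n

/-- The (affine) hyperelliptic curve `H₇` of genus 2. -/
def curveH7 : Set (ℂ × ℂ) :=
  {p | p.2 ^ 2 =
    p.1 * (1 - 63 / 4 * p.1 + 91 * p.1 ^ 2 - 231 * p.1 ^ 3 + 224 * p.1 ^ 4)}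

/-- The polynomial `P₇` in the coordinates `u, v` of `H₇`. -/
noncomputable def polyP7 (u v : ℂ) : ℂ :=
  v + 7 / 2 * u - 35 * u ^ 2 + 112 * u ^ 3 - 128 * u ^ 4

/-- The denominator of the covering `Ψ₇`. -/
noncomputable def denPsi7 (u v : ℂ) : ℂ :=
  u * (1 - 4 * u) ^ 7 * (-2 * v - 3 * u + 14 * u ^ 2) ^ 7

/-- The covering `Ψ₇ : H₇ → ℙ¹` of degree 21, as a rational function of `u, v`. -/
noncomputable def psi7 (u v : ℂ) : ℂ :=
  polyP7 u v ^ 2 * (2 * v - 3 * u + 14 * u ^ 2) ^ 7 / denPsi7 u v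

/-- The polynomial `P₁` in the coordinates `u, v` of `H₇`. -/
noncomputable def polyP1 (u v : ℂ) : ℂ :=
  1344 * u ^ 5 - 1540 * u ^ 4 + 784 * u ^ 3 - 204 * u ^ 2 + 53 / 2 * u - 11 / 8
    - 3 * (28 * u ^ 2 - 10 * u + 1) * v

/-- The polynomial `Q₁` in the coordinates `u, v` of `H₇`. -/
noncomputable def polyQ1 (u v : ℂ) : ℂ :=
  -112 * u ^ 4 + 84 * u ^ 3 - 25 * u ^ 2 + 5 / 2 * u + (16 * u ^ 2 - 4 * u + 1) * v

/-- `t ↦ (u t, v t)` is a holomorphic map from a connected open set `Ω ⊆ ℂ` to `H₇` that is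
unramified over the `u`-line. A (multivalued) analytic function on `H₇` is handled through its
single-valued branches along such maps: `Ω` may be a small disc in the `u`-line, or the universal
covering of `H₇` with finitely many points removed. -/
structure IsParamH7 (Ω : Set ℂ) (u v : ℂ → ℂ) : Prop where
  isOpen : IsOpen Ω
  isPreconnected : IsPreconnected Ω
  differentiableOn_u : DifferentiableOn ℂ u Ω
  differentiableOn_v : DifferentiableOn ℂ v Ω
  mem_curve : ∀ t ∈ Ω, (u t, v t) ∈ curveH7
  deriv_ne_zero : ∀ t ∈ Ω, deriv u t ≠ 0

/-- `s` is a holomorphic branch on `V` of the radical function `f ^ (1 / n)`. -/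
def IsRootBranch (n : ℕ) (V : Set ℂ) (f s : ℂ → ℂ) : Prop :=
  DifferentiableOn ℂ s V ∧ ∀ t ∈ V, s t ^ n = f t

/-- `W` is a branch on `Ω` of
`W₇ = (2v + 3u - 14u²)^(1/2) P₇^(1/14) u^(-2/7) ₃F₂(-1/14, 1/14, 5/14; 1/7, 5/7 | Ψ₇)`:
it is holomorphic on `Ω`, and on some nonempty open `V ⊆ Ω` with `‖Ψ₇‖ < 1` it is given by this
formula, with the convergent hypergeometric series and with some holomorphic branches of the
radicals. -/
def IsBranchW7 (Ω : Set ℂ) (u v W : ℂ → ℂ) : Prop :=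
  DifferentiableOn ℂ W Ω ∧
    ∃ (V : Set ℂ) (s p r : ℂ → ℂ), V ⊆ Ω ∧ IsOpen V ∧ V.Nonempty ∧
      IsRootBranch 2 V (fun t => 2 * v t + 3 * u t - 14 * u t ^ 2) s ∧
      IsRootBranch 14 V (fun t => polyP7 (u t) (v t)) p ∧
      IsRootBranch 7 V u r ∧
      ∀ t ∈ V, denPsi7 (u t) (v t) ≠ 0 ∧ ‖psi7 (u t) (v t)‖ < 1 ∧
        W t = s t * p t * r t ^ (-2 : ℤ) *
          hyp3F2 (-1 / 14) (1 / 14) (5 / 14) (1 / 7) (5 / 7) (psi7 (u t) (v t))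

/-- `W` is a branch on `Ω` of `(P₁ + ε Q₁ (56u - 21 + 2/u)^(1/2))^(1/4)`; here `ε = 1` gives `W₊`
and `ε = -1` gives `W₋`. It is holomorphic on `Ω` and given by the formula on some nonempty open
`V ⊆ Ω`, with some holomorphic branch of the square root. -/
def IsBranchWpm (ε : ℂ) (Ω : Set ℂ) (u v W : ℂ → ℂ) : Prop :=
  DifferentiableOn ℂ W Ω ∧
    ∃ (V : Set ℂ) (g : ℂ → ℂ), V ⊆ Ω ∧ IsOpen V ∧ V.Nonempty ∧
      IsRootBranch 2 V (fun t => 56 * u t - 21 + 2 / u t) g ∧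
      IsRootBranch 4 V (fun t => polyP1 (u t) (v t) + ε * polyQ1 (u t) (v t) * g t) W

/-- The derivation `d/du = (du/dt)⁻¹ d/dt`. -/
noncomputable def derivU (u f : ℂ → ℂ) : ℂ → ℂ := fun t => deriv f t / deriv u t

/-- `W` satisfies on `Ω` the equation `c₃ W''' + c₂ W'' + c₁ W' + c₀ W = 0`, with `' = d/du` and
with coefficients `cₖ ∈ ℂ[u][v]` (polynomials in `v` over `ℂ[u]`) evaluated along the curve. -/
def SatisfiesODE (c : Fin 4 → Polynomial (Polynomial ℂ)) (Ω : Set ℂ) (u v W : ℂ → ℂ) : Prop :=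
  ∀ t ∈ Ω, ∑ k : Fin 4, (c k).evalEval (u t) (v t) * ((derivU u)^[(k : ℕ)] W) t = 0

/-! Write `'` for `d/du`, `w = 4u - 1`, and look for an equation `W''' + a W'' + b (w W' - 4 W) = 0`
with `a`, `b` in the function field of the curve. This form has `w` itself, that is `W₀`, as a
solution for every `a` and `b`. Clearing the denominator `w³ c² q v⁴` gives `odeCoeff`.

For `W₇ = M · F(Ψ)`, with `M` the product of radicals, the logarithmic derivatives `m = M'/M` and `ℓ
= Ψ'/Ψ` lie in the function field, whatever branches are chosen. The Euler derivatives `Fₖ = (z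
d/dz)ᵏ F` at `z = Ψ` satisfy `Fₖ' = ℓ Fₖ₊₁`, so `W'''` is `M` times a combination of `F₀, …, F₃` in
which `F₃` has the coefficient `ℓ³`. The hypergeometric equation (`eulerSeries_hypCoeff_ode`)
eliminates `F₃`. Here `Ψ` enters only through `T = ℓ²/(1 - Ψ)`, as `ΨT = T - ℓ²`, and `T` has the
small denominator `c² q v²` (`quo_identity`). The coefficient of `F₂` then determines `a`, that of
`F₁` determines `b`, and that of `F₀` must vanish by itself: these are `ode_pref_two`,
`ode_pref_one` and `ode_pref_zero`.

For `W±` the logarithmic derivative `λ` lies in the quadratic extension of the function field by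
`√(u q)`. The equation becomes `λ'' + 3λλ' + λ³ + a(λ' + λ²) + b(wλ - 4) = 0`, which splits into a
rational part (`ode_lam_one`) and a part with the square root (`ode_lam_sqrt`).

All this is computed on an open set where the relevant denominators do not vanish. The left side of
the cleared equation is holomorphic on the connected set `Ω`, so its vanishing spreads to `Ω` by the
identity theorem (`satisfiesODE_of_subset`). -/

open Polynomial

/-! ### The hypergeometric series and its equation in Euler form. -/

/-- The power series of the Euler derivative `(z d/dz)^k` of `∑ aₙ zⁿ`. -/
noncomputable def eulerSeries (a : ℕ → ℂ) (k : ℕ) (z : ℂ) : ℂ := ∑' n : ℕ, (n : ℂ) ^ k * a n * z ^ n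

theorem summable_eulerSeries {a : ℕ → ℂ} (ha : ∀ n, ‖a n‖ ≤ 1) (k : ℕ) {z : ℂ} (hz : ‖z‖ < 1) :
    Summable fun n : ℕ => (n : ℂ) ^ k * a n * z ^ n := by
  have h := summable_pow_mul_geometric_of_norm_lt_one (R := ℝ) k (r := ‖z‖) (by simpa using hz)
  refine Summable.of_norm_bounded h fun n => ?_
  rw [norm_mul, norm_mul, norm_pow, norm_pow, Complex.norm_natCast]
  gcongr
  exact mul_le_of_le_one_right (by positivity) (ha n)

/-- Termwise differentiation on a disc of radius `r` strictly between `‖z‖` and `1`. Since `d/dz =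
z⁻¹ (z d/dz)`, the point `0` is excluded. -/
theorem hasDerivAt_eulerSeries {a : ℕ → ℂ} (ha : ∀ n, ‖a n‖ ≤ 1) (k : ℕ) {z : ℂ}
    (hz : ‖z‖ < 1) (hz0 : z ≠ 0) :
    HasDerivAt (eulerSeries a k) (eulerSeries a (k + 1) z / z) z := by
  obtain ⟨r, hr, hr1⟩ := exists_between hz
  have hr0 : 0 < r := (norm_nonneg z).trans_lt hr
  -- The majorant `n^(k+1) r^(n-1)`, written with `r⁻¹` to avoid the truncated exponent at `n = 0`.
  have hsum : Summable fun n : ℕ => r⁻¹ * ((n : ℝ) ^ (k + 1) * r ^ n) :=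
    (summable_pow_mul_geometric_of_norm_lt_one (R := ℝ) (k + 1) (r := r)
      (by rwa [Real.norm_of_nonneg hr0.le])).mul_left _
  have key := hasDerivAt_tsum_of_isPreconnected (𝕜 := ℂ)
    (g := fun (n : ℕ) (y : ℂ) => (n : ℂ) ^ k * a n * y ^ n)
    (g' := fun (n : ℕ) (y : ℂ) => (n : ℂ) ^ k * a n * (n * y ^ (n - 1)))
    (t := Metric.ball 0 r) (y₀ := z) (y := z) hsum Metric.isOpen_ball
    (convex_ball 0 r).isPreconnected ?_ ?_ (by simpa using hr)
    (summable_eulerSeries ha k hz) (by simpa using hr)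
  · refine key.congr_deriv (Eq.symm ?_)
    rw [show eulerSeries a (k + 1) z = ∑' n : ℕ, (n : ℂ) ^ (k + 1) * a n * z ^ n from rfl,
      ← tsum_div_const]
    refine tsum_congr fun n => ?_
    cases n with
    | zero => simp
    | succ n =>
      simp only [Nat.add_sub_cancel]
      field_simp
      ring
  · intro n y _
    exact (hasDerivAt_pow n y).const_mul _
  · intro n y hy
    have hy' : ‖y‖ ≤ r := by simpa using (Metric.mem_ball.1 hy).le
    cases n with
    | zero => simp
    | succ n =>
      rw [Nat.add_sub_cancel, norm_mul, norm_mul, norm_mul, norm_pow, norm_pow,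
        Complex.norm_natCast]
      calc ((n + 1 : ℕ) : ℝ) ^ k * ‖a (n + 1)‖ * (((n + 1 : ℕ) : ℝ) * ‖y‖ ^ n)
          ≤ ((n + 1 : ℕ) : ℝ) ^ k * 1 * (((n + 1 : ℕ) : ℝ) * r ^ n) := by
            gcongr; exact ha _
        _ = r⁻¹ * (((n + 1 : ℕ) : ℝ) ^ (k + 1) * r ^ (n + 1)) := by
            field_simp
            ring

/-- The Taylor coefficients of `₃F₂(-1/14, 1/14, 5/14; 1/7, 5/7 | z)`. -/
noncomputable def hypCoeff (n : ℕ) : ℂ :=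
  ((ascPochhammer ℂ n).eval (-1 / 14) * (ascPochhammer ℂ n).eval (1 / 14) *
      (ascPochhammer ℂ n).eval (5 / 14)) /
    ((ascPochhammer ℂ n).eval (1 / 7) * (ascPochhammer ℂ n).eval (5 / 7) * (Nat.factorial n : ℂ))

theorem hypCoeff_den_ne_zero (n : ℕ) :
    ((n : ℂ) + 1 / 7) * (n + 5 / 7) * (n + 1) ≠ 0 := by
  have h : ((n : ℂ) + 1 / 7) * (n + 5 / 7) * (n + 1)
      = (((n : ℝ) + 1 / 7) * (n + 5 / 7) * (n + 1) : ℝ) := by push_cast; ring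
  rw [h, Complex.ofReal_ne_zero]
  positivity

theorem hypCoeff_succ (n : ℕ) :
    hypCoeff (n + 1) = hypCoeff n * (((n : ℂ) - 1 / 14) * (n + 1 / 14) * (n + 5 / 14) /
      (((n : ℂ) + 1 / 7) * (n + 5 / 7) * (n + 1))) := by
  have h := hypCoeff_den_ne_zero n
  simp only [hypCoeff, ascPochhammer_succ_eval, Nat.factorial_succ, Nat.cast_mul, Nat.cast_add,
    Nat.cast_one]
  rw [div_mul_div_comm]
  congr 1 <;> ring

/-- Ratios of consecutive coefficients have modulus at most 1: factor by factor, `|n - 1/14| ≤ n +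
1/7`, `n + 1/14 ≤ n + 5/7` and `n + 5/14 ≤ n + 1`. This crude bound suffices for convergence and
differentiation in the unit disc. -/
theorem norm_hypCoeff_le (n : ℕ) : ‖hypCoeff n‖ ≤ 1 := by
  induction n with
  | zero => simp [hypCoeff]
  | succ n ih =>
    rw [hypCoeff_succ, norm_mul]
    refine mul_le_one₀ ih (norm_nonneg _) ?_
    have h : ((n : ℂ) - 1 / 14) * (n + 1 / 14) * (n + 5 / 14) /
        (((n : ℂ) + 1 / 7) * (n + 5 / 7) * (n + 1)) =
        ((((n : ℝ) - 1 / 14) * (n + 1 / 14) * (n + 5 / 14) /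
          (((n : ℝ) + 1 / 7) * (n + 5 / 7) * (n + 1)) : ℝ) : ℂ) := by push_cast; ring
    have hn : (0 : ℝ) ≤ n := Nat.cast_nonneg n
    have hpos : (0 : ℝ) < ((n : ℝ) + 1 / 7) * (n + 5 / 7) * (n + 1) := by positivity
    rw [h, Complex.norm_real, Real.norm_eq_abs, abs_div, abs_of_pos hpos, div_le_one hpos, abs_le]
    constructor <;> nlinarith [mul_nonneg hn hn, mul_nonneg hn (mul_nonneg hn hn)]

theorem hyp3F2_eq_eulerSeries (z : ℂ) :
    hyp3F2 (-1 / 14) (1 / 14) (5 / 14) (1 / 7) (5 / 7) z = eulerSeries hypCoeff 0 z := by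
  simp only [hyp3F2, eulerSeries, hypCoeff, pow_zero, one_mul]

/-- The hypergeometric differential equation. -/
theorem eulerSeries_hypCoeff_ode {z : ℂ} (hz : ‖z‖ < 1) :
    (1 - z) * eulerSeries hypCoeff 3 z =
      (8 / 7 + 5 / 14 * z) * eulerSeries hypCoeff 2 z
        - (12 / 49 + z / 196) * eulerSeries hypCoeff 1 z
        - 5 / 2744 * z * eulerSeries hypCoeff 0 z := by
  have hs := fun k => summable_eulerSeries norm_hypCoeff_le k hz
  have h3 := (hs 3).hasSum
  have h2 := (hs 2).hasSum
  have h1 := (hs 1).hasSum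
  have h0 := (hs 0).hasSum
  have hL := (h3.sub (h2.mul_left (8 / 7))).add (h1.mul_left (12 / 49))
  have hR := (((h3.add (h2.mul_left (5 / 14))).sub (h1.mul_left (1 / 196))).sub
    (h0.mul_left (5 / 2744))).mul_left z
  -- With `θ = z d/dz` the equation reads `θ(θ - 6/7)(θ - 2/7)F = z(θ - 1/14)(θ + 1/14)(θ + 5/14)F`.
  -- The factor `θ` kills the constant term on the left; after this shift the coefficients of `zⁿ⁺¹`
  -- match by the recurrence.
  have hL' := (hasSum_nat_add_iff' 1).2 hL
  have := hL'.unique (hR.congr_fun ?_)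
  · simp only [eulerSeries]
    simp only [Finset.sum_range_one, Nat.cast_zero, ne_eq, OfNat.ofNat_ne_zero, not_false_eq_true,
      one_ne_zero, zero_pow, zero_mul, mul_zero, sub_zero, add_zero] at this
    linear_combination this
  · intro n
    have h : hypCoeff (n + 1) * (((n : ℂ) + 1 / 7) * (n + 5 / 7) * (n + 1)) =
        hypCoeff n * (((n : ℂ) - 1 / 14) * (n + 1 / 14) * (n + 5 / 14)) := by
      rw [hypCoeff_succ, mul_assoc, div_mul_cancel₀ _ (hypCoeff_den_ne_zero n)]
    push_cast
    linear_combination z ^ (n + 1) * h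

/-! ### Differentiation with respect to `u` along a curve -/

/-- On `V` the function `f` has the derivative `f'` with respect to `u`. -/
def HasDerivU (u : ℂ → ℂ) (V : Set ℂ) (f f' : ℂ → ℂ) : Prop :=
  ∀ t ∈ V, HasDerivAt f (f' t * deriv u t) t

/-- On `V` the function `f` has the logarithmic derivative `κ` with respect to `u`. -/
def HasLogDerivU (u : ℂ → ℂ) (V : Set ℂ) (f κ : ℂ → ℂ) : Prop :=
  HasDerivU u V f fun t => f t * κ t

namespace HasDerivU

variable {u : ℂ → ℂ} {V : Set ℂ} {f g f' g' : ℂ → ℂ}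

theorem congr_deriv (hf : HasDerivU u V f f') (h : ∀ t ∈ V, f' t = g' t) : HasDerivU u V f g' :=
  fun t ht => h t ht ▸ hf t ht

theorem congr_fun (hf : HasDerivU u V f f') (hV : IsOpen V) (h : ∀ t ∈ V, g t = f t) :
    HasDerivU u V g f' :=
  fun t ht => (hf t ht).congr_of_eventuallyEq (Filter.eventuallyEq_of_mem (hV.mem_nhds ht) h)

theorem const (c : ℂ) : HasDerivU u V (fun _ => c) fun _ => 0 := fun t _ => by
  simpa using hasDerivAt_const t c

theorem add (hf : HasDerivU u V f f') (hg : HasDerivU u V g g') :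
    HasDerivU u V (fun t => f t + g t) fun t => f' t + g' t := fun t ht => by
  rw [add_mul]; exact (hf t ht).add (hg t ht)

theorem mul (hf : HasDerivU u V f f') (hg : HasDerivU u V g g') :
    HasDerivU u V (fun t => f t * g t) fun t => f' t * g t + f t * g' t := fun t ht => by
  refine ((hf t ht).mul (hg t ht)).congr_deriv ?_
  ring

theorem const_mul (c : ℂ) (hf : HasDerivU u V f f') :
    HasDerivU u V (fun t => c * f t) fun t => c * f' t := fun t ht => by
  rw [mul_assoc]; exact (hf t ht).const_mul c

theorem comp {φ φ' : ℂ → ℂ} (hf : HasDerivU u V f f')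
    (hφ : ∀ t ∈ V, HasDerivAt φ (φ' t) (f t)) :
    HasDerivU u V (fun t => φ (f t)) fun t => φ' t * f' t := fun t ht => by
  rw [mul_assoc]; exact (hφ t ht).comp t (hf t ht)

theorem hasLogDerivU {κ : ℂ → ℂ} (hf : HasDerivU u V f f') (h : ∀ t ∈ V, f' t = f t * κ t) :
    HasLogDerivU u V f κ := hf.congr_deriv h

/-- The quotient rule, with the denominator differentiated logarithmically. -/
theorem div_of_log {E κ : ℂ → ℂ} (hf : HasDerivU u V f f') (hE : HasLogDerivU u V E κ)
    (h0 : ∀ t ∈ V, E t ≠ 0) :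
    HasDerivU u V (fun t => f t / E t) fun t => (f' t - f t * κ t) / E t := fun t ht => by
  refine ((hf t ht).div (hE t ht) (h0 t ht)).congr_deriv ?_
  have := h0 t ht
  field_simp

theorem derivU_eq (hf : HasDerivU u V f f') (hu : ∀ t ∈ V, deriv u t ≠ 0) :
    ∀ t ∈ V, derivU u f t = f' t := fun t ht => by
  rw [derivU, (hf t ht).deriv, mul_div_cancel_right₀ _ (hu t ht)]

end HasDerivU

namespace HasLogDerivU

variable {u : ℂ → ℂ} {V : Set ℂ} {f g κ μ : ℂ → ℂ}

theorem congr_log (hf : HasLogDerivU u V f κ) (h : ∀ t ∈ V, κ t = μ t) : HasLogDerivU u V f μ :=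
  HasDerivU.congr_deriv hf fun t ht => by rw [h t ht]

theorem congr_fun (hf : HasLogDerivU u V f κ) (hV : IsOpen V) (h : ∀ t ∈ V, g t = f t) :
    HasLogDerivU u V g κ :=
  (HasDerivU.congr_fun hf hV h).congr_deriv fun t ht => by rw [h t ht]

theorem mul (hf : HasLogDerivU u V f κ) (hg : HasLogDerivU u V g μ) :
    HasLogDerivU u V (fun t => f t * g t) fun t => κ t + μ t :=
  (HasDerivU.mul hf hg).congr_deriv fun t _ => by ring

theorem inv (hf : HasLogDerivU u V f κ) (h0 : ∀ t ∈ V, f t ≠ 0) :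
    HasLogDerivU u V (fun t => (f t)⁻¹) fun t => -κ t := fun t ht => by
  refine ((hf t ht).inv (h0 t ht)).congr_deriv ?_
  have := h0 t ht
  field_simp

theorem pow (hf : HasLogDerivU u V f κ) (n : ℕ) :
    HasLogDerivU u V (fun t => f t ^ n) fun t => n * κ t := by
  induction n with
  | zero => simpa [HasLogDerivU] using HasDerivU.const (u := u) (V := V) 1
  | succ n ih =>
    simp only [pow_succ]
    refine (ih.mul hf).congr_log fun t _ => ?_
    push_cast
    ring

theorem div (hf : HasLogDerivU u V f κ) (hg : HasLogDerivU u V g μ) (h0 : ∀ t ∈ V, g t ≠ 0) :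
    HasLogDerivU u V (fun t => f t / g t) fun t => κ t - μ t := by
  simpa only [div_eq_mul_inv, sub_eq_add_neg] using hf.mul (hg.inv h0)

/-- The logarithmic derivative of a radical. -/
theorem of_isRootBranch {s : ℂ → ℂ} {n : ℕ} (hn : n ≠ 0) (hV : IsOpen V)
    (hs : IsRootBranch n V f s) (hf : HasLogDerivU u V f κ) (h0 : ∀ t ∈ V, f t ≠ 0) :
    HasLogDerivU u V s fun t => κ t / n := fun t ht => by
  have hd := (hs.1.differentiableAt (hV.mem_nhds ht)).hasDerivAt
  have hne : s t ≠ 0 := fun h => h0 t ht (by rw [← hs.2 t ht, h, zero_pow hn])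
  have h1 : HasDerivAt f (n * s t ^ (n - 1) * deriv s t) t :=
    (hd.pow n).congr_of_eventuallyEq
      (Filter.eventuallyEq_of_mem (hV.mem_nhds ht) fun x hx => (hs.2 x hx).symm)
  have h2 := h1.unique (hf t ht)
  beta_reduce at h2
  rw [← hs.2 t ht] at h2
  obtain ⟨m, rfl⟩ := Nat.exists_eq_succ_of_ne_zero hn
  rw [Nat.succ_sub_one, pow_succ] at h2
  have hm : ((m.succ : ℕ) : ℂ) ≠ 0 := Nat.cast_ne_zero.2 hn
  -- Differentiating `sⁿ = f` gives `n sⁿ⁻¹ s' = f κ = sⁿ κ`; the factor `n sⁿ⁻¹` is cancelled.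
  refine hd.congr_deriv (mul_left_cancel₀ (mul_ne_zero hm (pow_ne_zero m hne)) ?_)
  beta_reduce
  rw [← mul_assoc, h2]
  field_simp

end HasLogDerivU

theorem IsRootBranch.mono {n : ℕ} {V V' : Set ℂ} {f s : ℂ → ℂ} (h : IsRootBranch n V f s)
    (hV : V' ⊆ V) : IsRootBranch n V' f s :=
  ⟨h.1.mono hV, fun t ht => h.2 t (hV ht)⟩

/-! ### Polynomials by coefficient lists, and elements `A(u) + v B(u)` of the function field. -/

/-- The polynomial with the given list of coefficients, the constant coefficient first. -/
noncomputable def ofCoeffs : List ℂ → ℂ[X]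
  | [] => 0
  | a :: l => C a + X * ofCoeffs l

theorem eval_ofCoeffs_nil (x : ℂ) : (ofCoeffs []).eval x = 0 := eval_zero

theorem eval_ofCoeffs_cons (a : ℂ) (l : List ℂ) (x : ℂ) :
    (ofCoeffs (a :: l)).eval x = a + x * (ofCoeffs l).eval x := by simp [ofCoeffs]

theorem eval_derivative_ofCoeffs_nil (x : ℂ) : (derivative (ofCoeffs [])).eval x = 0 := by
  simp [ofCoeffs]

theorem eval_derivative_ofCoeffs_cons (a : ℂ) (l : List ℂ) (x : ℂ) :
    (derivative (ofCoeffs (a :: l))).eval x =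
      (ofCoeffs l).eval x + x * (derivative (ofCoeffs l)).eval x := by simp [ofCoeffs]

/-- `A(u) + v B(u)`, an element of the function field of a hyperelliptic curve. -/
noncomputable def lin (A B : ℂ[X]) (u v : ℂ) : ℂ := A.eval u + v * B.eval u

theorem hasDerivU_self {u : ℂ → ℂ} {V : Set ℂ} (h : ∀ t ∈ V, DifferentiableAt ℂ u t) :
    HasDerivU u V u fun _ => 1 := fun t ht => by
  simpa using (h t ht).hasDerivAt

theorem HasDerivU.eval {u : ℂ → ℂ} {V : Set ℂ} (h : HasDerivU u V u fun _ => 1) (A : ℂ[X]) :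
    HasDerivU u V (fun t => A.eval (u t)) fun t => A.derivative.eval (u t) :=
  (h.comp fun t _ => A.hasDerivAt (u t)).congr_deriv fun _ _ => mul_one _

/-- A nonconstant function avoids the zeros of a polynomial on a nonempty open set. -/
theorem exists_open_subset_eval_ne_zero {u : ℂ → ℂ} {V : Set ℂ} (hV : IsOpen V) (hne : V.Nonempty)
    (hd : ∀ t ∈ V, deriv u t ≠ 0) {A : ℂ[X]} (hA : A ≠ 0) :
    ∃ V' ⊆ V, IsOpen V' ∧ V'.Nonempty ∧ ∀ t ∈ V', A.eval (u t) ≠ 0 := by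
  have hdiff : ∀ t ∈ V, DifferentiableAt ℂ u t := fun t ht =>
    differentiableAt_of_deriv_ne_zero (hd t ht)
  refine ⟨V ∩ (fun t => A.eval (u t)) ⁻¹' {0}ᶜ, Set.inter_subset_left, ?_, ?_, fun t ht => ht.2⟩
  · refine ContinuousOn.isOpen_inter_preimage (fun t ht => ?_) hV isOpen_compl_singleton
    exact (A.continuous.continuousAt.comp (hdiff t ht).continuousAt).continuousWithinAt
  · obtain ⟨t₀, ht₀⟩ := hne
    -- As `u' ≠ 0` at `t₀`, near but outside `t₀` the function `u` misses each of the finitely many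
    -- roots.
    have h1 : ∀ᶠ t in nhdsWithin t₀ {t₀}ᶜ, ∀ x ∈ A.roots.toFinset, u t ≠ x :=
      (Filter.eventually_all_finset _).2 fun x _ =>
        (hdiff t₀ ht₀).hasDerivAt.eventually_ne (hd t₀ ht₀)
    have h2 : ∀ᶠ t in nhdsWithin t₀ {t₀}ᶜ, t ∈ V :=
      nhdsWithin_le_nhds (hV.mem_nhds ht₀)
    obtain ⟨t, h1t, h2t⟩ := (h1.and h2).exists
    refine ⟨t, h2t, fun h0 => h1t (u t) ?_ rfl⟩
    rw [Multiset.mem_toFinset, mem_roots hA]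
    exact h0

/-! ### The curve, its special points, and derivatives on generic open sets. -/

/-- `H₇` is the curve `v² = fH7(u)`. -/
noncomputable def fH7 : ℂ[X] := ofCoeffs [0, 1, -63 / 4, 91, -231, 224]

/-- The polynomial with `fH7 = X * f₀H7`. -/
noncomputable def f₀H7 : ℂ[X] := ofCoeffs [1, -63 / 4, 91, -231, 224]

theorem fH7_eq (x : ℂ) : fH7.eval x = x * f₀H7.eval x := by
  simp only [fH7, f₀H7, eval_ofCoeffs_cons, zero_add]

/-- `4u - 1`. -/
noncomputable def wH7 : ℂ[X] := ofCoeffs [-1, 4]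

/-- `56u² - 21u + 2`. -/
noncomputable def qH7 : ℂ[X] := ofCoeffs [2, -21, 56]

/-- `1 - 14u + 56u² - 56u³`; together with `u` and `4u - 1` it gives the poles and zeros of
`Ψ₇`. -/
noncomputable def cH7 : ℂ[X] := ofCoeffs [1, -14, 56, -56]

/-- `1 - 16u + 56u²`; together with `4u - 1` it gives the zeros of `W₊ W₋`. -/
noncomputable def hH7 : ℂ[X] := ofCoeffs [1, -16, 56]

/-- An open set with an unramified map to `H₇` that avoids the special points of the curve. -/
structure IsGenericH7 (V : Set ℂ) (u v : ℂ → ℂ) : Prop where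
  isOpen : IsOpen V
  deriv_ne_zero : ∀ t ∈ V, deriv u t ≠ 0
  hasDerivU_u : HasDerivU u V u fun _ => 1
  differentiableOn_v : DifferentiableOn ℂ v V
  sq_eq : ∀ t ∈ V, v t ^ 2 = fH7.eval (u t)
  u_ne : ∀ t ∈ V, u t ≠ 0
  v_ne : ∀ t ∈ V, v t ≠ 0
  w_ne : ∀ t ∈ V, wH7.eval (u t) ≠ 0
  q_ne : ∀ t ∈ V, qH7.eval (u t) ≠ 0
  c_ne : ∀ t ∈ V, cH7.eval (u t) ≠ 0
  h_ne : ∀ t ∈ V, hH7.eval (u t) ≠ 0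

theorem sq_eq_fH7_eval {u v : ℂ} (h : (u, v) ∈ curveH7) : v ^ 2 = fH7.eval u := by
  have h' : v ^ 2 = u * (1 - 63 / 4 * u + 91 * u ^ 2 - 231 * u ^ 3 + 224 * u ^ 4) := h
  rw [h']
  simp only [fH7, eval_ofCoeffs_cons, eval_ofCoeffs_nil]
  ring

/-- Every nonempty open subset of the source of a parametrization contains a generic one. -/
theorem IsParamH7.exists_generic {Ω V : Set ℂ} {u v : ℂ → ℂ} (hp : IsParamH7 Ω u v) (hV : IsOpen V)
    (hne : V.Nonempty) (hVΩ : V ⊆ Ω) : ∃ V' ⊆ V, V'.Nonempty ∧ IsGenericH7 V' u v := by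
  -- At `1` none of the factors vanishes.
  have hA : X * fH7 * wH7 * qH7 * cH7 * hH7 ≠ 0 := fun h0 => by
    have := congrArg (Polynomial.eval 1) h0
    simp [fH7, wH7, qH7, cH7, hH7, ofCoeffs] at this
    norm_num at this
  obtain ⟨V', hV'V, hV', hne', h⟩ := exists_open_subset_eval_ne_zero hV hne
    (fun t ht => hp.deriv_ne_zero t (hVΩ ht)) hA
  have hΩ : V' ⊆ Ω := hV'V.trans hVΩ
  simp only [eval_mul, eval_X, mul_ne_zero_iff] at h
  have hc : ∀ t ∈ V', v t ^ 2 = fH7.eval (u t) := fun t ht =>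
    sq_eq_fH7_eval (hp.mem_curve t (hΩ ht))
  refine ⟨V', hV'V, hne', hV', fun t ht => hp.deriv_ne_zero t (hΩ ht),
    hasDerivU_self fun t ht => differentiableAt_of_deriv_ne_zero (hp.deriv_ne_zero t (hΩ ht)),
    hp.differentiableOn_v.mono hΩ, hc, fun t ht => (h t ht).1.1.1.1.1, fun t ht h0 => ?_,
    fun t ht => (h t ht).1.1.1.2, fun t ht => (h t ht).1.1.2, fun t ht => (h t ht).1.2,
    fun t ht => (h t ht).2⟩
  have := hc t ht
  rw [h0, zero_pow two_ne_zero] at this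
  exact (h t ht).1.1.1.1.2 this.symm

namespace IsGenericH7

variable {V : Set ℂ} {u v : ℂ → ℂ}

theorem hasLogDerivU_eval (hG : IsGenericH7 V u v) (A : ℂ[X]) (h : ∀ t ∈ V, A.eval (u t) ≠ 0) :
    HasLogDerivU u V (fun t => A.eval (u t))
      fun t => A.derivative.eval (u t) / A.eval (u t) :=
  (hG.hasDerivU_u.eval A).hasLogDerivU fun t ht => by rw [mul_div_cancel₀ _ (h t ht)]

theorem f_ne (hG : IsGenericH7 V u v) : ∀ t ∈ V, fH7.eval (u t) ≠ 0 := fun t ht => by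
  rw [← hG.sq_eq t ht]
  exact pow_ne_zero 2 (hG.v_ne t ht)

theorem hasLogDerivU_v (hG : IsGenericH7 V u v) :
    HasLogDerivU u V v fun t => fH7.derivative.eval (u t) / (2 * v t ^ 2) :=
  (HasLogDerivU.of_isRootBranch two_ne_zero hG.isOpen ⟨hG.differentiableOn_v, hG.sq_eq⟩
    (hG.hasLogDerivU_eval fH7 hG.f_ne) hG.f_ne).congr_log fun t ht => by
      rw [← hG.sq_eq t ht]
      push_cast
      rw [div_div, mul_comm (2 : ℂ)]

theorem hasDerivU_lin (hG : IsGenericH7 V u v) (A B : ℂ[X]) :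
    HasDerivU u V (fun t => lin A B (u t) (v t)) fun t =>
      lin A.derivative B.derivative (u t) (v t)
        + fH7.derivative.eval (u t) / (2 * v t) * B.eval (u t) :=
  ((hG.hasDerivU_u.eval A).add (HasDerivU.mul hG.hasLogDerivU_v
    (hG.hasDerivU_u.eval B))).congr_deriv fun t ht => by
      have := hG.v_ne t ht
      simp only [lin]
      field_simp
      ring

/-- Derivative of an element of the function field with the denominator `eᵏ vʲ`. -/
theorem hasDerivU_div (hG : IsGenericH7 V u v) {e A B A₁ B₁ : ℂ[X]} (k j : ℕ)
    (he : ∀ t ∈ V, e.eval (u t) ≠ 0)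
    (hid : ∀ x y : ℂ, y ^ 2 = fH7.eval x →
      2 * lin A₁ B₁ x y + lin A B x y *
          (2 * k * e.derivative.eval x * y ^ 2 + j * e.eval x * fH7.derivative.eval x) =
        e.eval x * (2 * y ^ 2 * lin A.derivative B.derivative x y
          + y * fH7.derivative.eval x * B.eval x)) :
    HasDerivU u V (fun t => lin A B (u t) (v t) / (e.eval (u t) ^ k * v t ^ j))
      fun t => lin A₁ B₁ (u t) (v t) / (e.eval (u t) ^ (k + 1) * v t ^ (j + 2)) :=
  ((hG.hasDerivU_lin A B).div_of_log
    (((hG.hasLogDerivU_eval e he).pow k).mul (hG.hasLogDerivU_v.pow j))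
    fun t ht => mul_ne_zero (pow_ne_zero _ (he t ht)) (pow_ne_zero _ (hG.v_ne t ht))).congr_deriv
    fun t ht => by
      have h1 := he t ht
      have h2 := hG.v_ne t ht
      have h3 := hid (u t) (v t) (hG.sq_eq t ht)
      rw [show e.eval (u t) ^ (k + 1) * v t ^ (j + 2) =
        e.eval (u t) * v t ^ 2 * (e.eval (u t) ^ k * v t ^ j) by ring, ← div_div (lin A₁ B₁ _ _)]
      congr 1
      field_simp
      linear_combination -h3

theorem hasLogDerivU_sqrt (hG : IsGenericH7 V u v) {y : ℂ → ℂ} (hy : DifferentiableOn ℂ y V)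
    (hy2 : ∀ t ∈ V, y t ^ 2 = u t * qH7.eval (u t)) :
    HasLogDerivU u V y fun t =>
      (1 / u t + qH7.derivative.eval (u t) / qH7.eval (u t)) / 2 := by
  have h := (hG.hasLogDerivU_eval X (by simpa using hG.u_ne)).mul
    (hG.hasLogDerivU_eval qH7 hG.q_ne)
  simp only [eval_X, derivative_X, eval_one] at h
  exact_mod_cast HasLogDerivU.of_isRootBranch two_ne_zero hG.isOpen ⟨hy, hy2⟩ h
    fun t ht => mul_ne_zero (hG.u_ne t ht) (hG.q_ne t ht)

/-- Derivative of an element with the denominator `eᵏ qⁱ vʲ y`, where `y² = u q(u)`. -/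
theorem hasDerivU_div_sqrt (hG : IsGenericH7 V u v) {y : ℂ → ℂ} (hy : DifferentiableOn ℂ y V)
    (hy2 : ∀ t ∈ V, y t ^ 2 = u t * qH7.eval (u t)) {e A B A₁ B₁ : ℂ[X]} (k i j : ℕ)
    (he : ∀ t ∈ V, e.eval (u t) ≠ 0)
    (hid : ∀ x y : ℂ, y ^ 2 = fH7.eval x →
      2 * lin A₁ B₁ x y + lin A B x y *
          (2 * k * e.derivative.eval x * qH7.eval x * y ^ 2
            + (2 * i + 1) * e.eval x * qH7.derivative.eval x * y ^ 2
            + j * e.eval x * qH7.eval x * fH7.derivative.eval x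
            + e.eval x * qH7.eval x * f₀H7.eval x) =
        e.eval x * qH7.eval x * (2 * y ^ 2 * lin A.derivative B.derivative x y
          + y * fH7.derivative.eval x * B.eval x)) :
    HasDerivU u V
      (fun t => lin A B (u t) (v t) / (e.eval (u t) ^ k * qH7.eval (u t) ^ i * v t ^ j * y t))
      fun t => lin A₁ B₁ (u t) (v t) /
        (e.eval (u t) ^ (k + 1) * qH7.eval (u t) ^ (i + 1) * v t ^ (j + 2) * y t) := by
  have hy0 : ∀ t ∈ V, y t ≠ 0 := fun t ht h0 => by
    have := hy2 t ht
    rw [h0, zero_pow two_ne_zero] at this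
    exact mul_ne_zero (hG.u_ne t ht) (hG.q_ne t ht) this.symm
  have hE0 : ∀ k i j : ℕ, ∀ t ∈ V,
      e.eval (u t) ^ k * qH7.eval (u t) ^ i * v t ^ j * y t ≠ 0 := fun k i j t ht =>
    mul_ne_zero (mul_ne_zero (mul_ne_zero (pow_ne_zero _ (he t ht)) (pow_ne_zero _ (hG.q_ne t ht)))
      (pow_ne_zero _ (hG.v_ne t ht))) (hy0 t ht)
  refine ((hG.hasDerivU_lin A B).div_of_log
    (((((hG.hasLogDerivU_eval e he).pow k).mul ((hG.hasLogDerivU_eval qH7 hG.q_ne).pow i)).mul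
      (hG.hasLogDerivU_v.pow j)).mul (hG.hasLogDerivU_sqrt hy hy2)) (hE0 k i j)).congr_deriv
    fun t ht => ?_
  have h1 := he t ht
  have h2 := hG.v_ne t ht
  have h3 := hid (u t) (v t) (hG.sq_eq t ht)
  have h4 := hG.q_ne t ht
  have h5 := hG.u_ne t ht
  have h6 := hy0 t ht
  have h7 : v t ^ 2 = u t * f₀H7.eval (u t) := by
    rw [hG.sq_eq t ht, fH7_eq]
  -- The `1/u` in `y'/y = (1/u + q'/q)/2` becomes the polynomial `f₀` after multiplication by `v²`,
  -- because `u` divides `fH7`. So `hid` needs no division.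
  have h8 : f₀H7.eval (u t) = v t ^ 2 / u t := by rw [h7, mul_div_cancel_left₀ _ h5]
  rw [h8] at h3
  rw [show e.eval (u t) ^ (k + 1) * qH7.eval (u t) ^ (i + 1) * v t ^ (j + 2) * y t =
    e.eval (u t) * qH7.eval (u t) * v t ^ 2 *
      (e.eval (u t) ^ k * qH7.eval (u t) ^ i * v t ^ j * y t) by ring, ← div_div (lin A₁ B₁ _ _)]
  congr 1
  field_simp at h3 ⊢
  linear_combination -h3

end IsGenericH7

/-! ### Numerators of the logarithmic derivatives, of their derivatives, and of the coefficients of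
the equation. -/

/-- The logarithmic derivative of `s p r⁻²` is `(prefA + v prefB) / (w c v)`. -/
noncomputable def prefA : ℂ[X] := ofCoeffs [-1/2, 31/4, -77/2, 35, 210, -392]

noncomputable def prefB : ℂ[X] := ofCoeffs [11/2, -70, 266, -280]

/-- The index counts derivatives: the numerators with index 1 and 2 belong to `m'` over `(wc)² v³`
and to `m''` over `(wc)³ v⁵`. -/
noncomputable def pref₁A : ℂ[X] := ofCoeffs [-1/4, 35/2, -2015/4, 65807/8, -345471/4, 1236347/2,
  -3088141, 10730510, -24963148, 34439160, -14482832, -34420736, 58919168, -29503488]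

noncomputable def pref₁B : ℂ[X] := ofCoeffs [0, -29, 4627/4, -20496, 212051, -1416324, 6372548,
  -19539632, 40285840, -53431168, 41181952, -14049280]

noncomputable def pref₂A : ℂ[X] := ofCoeffs [-3/8, 581/16, -13581/8, 100111/2, -2068829/2,
  63441973/4, -747785689/4, 1734069862, -12856039742, 76919758804, -373203587456, 1468735595768,
  -4666958600528, 11846628130176, -23557621503808, 35413435865472, -37391257195264, 22347262092288,
  1811150286848, -16093208592384, 12799006474240, -3700917534720]

noncomputable def pref₂B : ℂ[X] := ofCoeffs [0, 0, 344, -22764, 1410899/2, -27179131/2, 182152705,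
  -1801831234, 13612883844, -80190414136, 372710172352, -1373995469728, 4016157935552,
  -9252555416832, 16593396590848, -22680853113856, 22827271548928, -15954974916608, 6926002814976,
  -1409873346560]

/-- The logarithmic derivative of `Ψ₇` is `ellA / (c v)`. -/
noncomputable def ellA : ℂ[X] := ofCoeffs [-7, 49, 98, -1372, 2744]

/-- Numerators of `ℓ'` over `c² v³` and, with index 2, of `ℓ''` over `c³ v⁵`. -/
noncomputable def ell₁A : ℂ[X] := ofCoeffs [7/2, -931/4, 11025/2, -136465/2, 502985, -2283694,
  5975060, -5380984, -17709776, 68303648, -95732672, 51631104]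

noncomputable def ell₂A : ℂ[X] := ofCoeffs [-21/4, 1813/4, -152733/8, 990437/2, -8693188, 109115846,
  -1014719881, 7151744824, -38689233800, 161165953312, -512734279904, 1212840525344, -1988332101056,
  1761476862208, 731014683392, -4818119968256, 7091377241088, -5194777477120, 1619151421440]

/-- With `ℓ = Ψ₇' / Ψ₇` one has `ℓ² / (1 - Ψ₇) = (quoA + v quoB) / (c² q v²)`. -/
noncomputable def quoA : ℂ[X] := ofCoeffs [49, -2401/2, 9604, -2401/2, -436982, 2521050, -2151296,
  -32941720, 154355488, -289887136, 210827008]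

noncomputable def quoB : ℂ[X] := ofCoeffs [343, -9604, 117649, -830746, 3707144, -10487568,
  16941456, -10218656, -4302592]

/-- The coefficient of `W''` in the normalized equation is `(odeTwoA + v odeTwoB) / (w c q v²)`. -/
noncomputable def odeTwoA : ℂ[X] := ofCoeffs [-3, 231/2, -16275/8, 86163/4, -301791/2, 722820,
  -2357292, 5023284, -6317472, 3556224]

noncomputable def odeTwoB : ℂ[X] := ofCoeffs [-5/2, 161/4, -63, -2821, 26278, -105644, 211680,
  -175616]

/-- The normalized equation ends with `b (w W' - 4 W)`, `b = (odeOneA + v odeOneB) / (w³ c² q v⁴)`. -/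
noncomputable def odeOneA : ℂ[X] := ofCoeffs [0, 18, -4503/4, 528255/16, -4822153/8, 61332173/8,
  -144001781/2, 516066873, -2875144090, 12547886680, -42818318760, 112717675280, -221613474432,
  301564667040, -221043205376, -64643371520, 348052647936, -349990043648, 132175626240]

noncomputable def odeOneB : ℂ[X] := ofCoeffs [5/4, -185/4, 5733/8, -13069/2, 235123/4, -1589707/2,
  10101203, -91372750, 580339732, -2650249672, 8829330384, -21444919776, 37257461248, -44185161216,
  32266981376, -11014635520]

/-- The logarithmic derivative of `W±` is `((lamA + v lamB) + (muA + v muB) / y) / (w h v)`, `y² = u q`. -/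
noncomputable def lamA : ℂ[X] := ofCoeffs [-1, 35/2, -105, 224, -56]

noncomputable def lamB : ℂ[X] := ofCoeffs [7, -92, 280]

noncomputable def lam₁A : ℂ[X] := ofCoeffs [-1/2, 37, -1084, 17661, -182070, 1258096, -5948544,
  19119408, -40283488, 51097984, -31748864, 4214784]

noncomputable def lam₁B : ℂ[X] := ofCoeffs [0, -48, 1876, -32152, 313992, -1904448, 7332640,
  -17500672, 23720704, -14049280]

noncomputable def lam₂A : ℂ[X] := ofCoeffs [-3/4, 617/8, -15183/4, 115549, -2415868, 36794618,
  -423693046, 3779013252, -26506149824, 147394569168, -651102585728, 2275676518080, -6226104577280,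
  13079832088064, -20438782959616, 22528722944000, -15915142397952, 5850344980480, -528702504960]

noncomputable def lam₂B : ℂ[X] := ofCoeffs [0, 0, 800, -50352, 1480402, -26931508, 338351440,
  -3101916608, 21374553760, -112339094336, 452115664896, -1385642578432, 3182307229696,
  -5310653931520, 6089548021760, -4297596076032, 1409873346560]

noncomputable def muA : ℂ[X] := ofCoeffs [0, 5/2, -95/2, 343, -1120, 1400]

noncomputable def muB : ℂ[X] := ofCoeffs [-1, 15, -84, 168]

/-- Differentiating the part with `1/y` also produces powers of `q`: the denominators are `(wh)² q
v³ y` and, with index 2, `(wh)³ q² v⁵ y`. -/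
noncomputable def mu₁A : ℂ[X] := ofCoeffs [0, 0, -565/8, 7881/2, -201405/2, 3119445/2, -16317469,
  121556050, -661568740, 2651929392, -7774073440, 16258748800, -23032389632, 19846364160,
  -7867596800]

noncomputable def mu₁B : ℂ[X] := ofCoeffs [-1, 327/4, -5405/2, 50760, -620333, 5277720, -32359572,
  144926208, -472201632, 1093642368, -1710675456, 1623745536, -708083712]

noncomputable def mu₂A : ℂ[X] := ofCoeffs [0, 0, 0, 106583/32, -9795165/32, 213596615/16,
  -734892491/2, 7160268255, -105031018820, 1203687137772, -11039606070780, 82321666184240,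
  -504201245586696, 2551154247846960, -10685927366448320, 36999614532447616, -105349870611901440,
  244315239117644800, -454442472686870528, 662152398943150080, -728400710742835200,
  569086597674434560, -281536198701219840, 66320442222182400]

noncomputable def mu₂B : ℂ[X] := ofCoeffs [-3, 727/2, -339771/16, 12455301/16, -19916712, 377436683,
  -5505001530, 63448530558, -588774437160, 4457194713832, -27773272718352, 143201742503120,
  -612191690802048, 2166976682838912, -6319144109354496, 15037858193777664, -28761007144955904,
  43177801615613952, -49037748820967424, 39634070935044096, -20325439100682240, 4974033166663680]

/-! ### Polynomial identities on the curve: derivatives of the logarithmic derivatives. -/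

/-- The quotient rule for `m`, cleared of denominators. This and the next identities have the exact
shape of the hypothesis `hid` of `hasDerivU_div`, which explains the numeral casts and the trivial
factors. -/
theorem deriv_pref (x y : ℂ) (h : y ^ 2 = fH7.eval x) :
    2 * lin pref₁A pref₁B x y + lin prefA prefB x y * (2 * (1 : ℕ) * (derivative (wH7 * cH7)).eval x
      * y ^ 2 + (1 : ℕ) * ((wH7 * cH7)).eval x * fH7.derivative.eval x) = ((wH7 * cH7)).eval x * (2
      * y ^ 2 * lin prefA.derivative (derivative prefB) x y + y * fH7.derivative.eval x * (prefB :
      ℂ[X]).eval x) := by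
  simp only [lin, fH7, wH7, cH7, prefA, prefB, pref₁A, pref₁B, eval_mul, derivative_mul, eval_add,
    eval_ofCoeffs_cons, eval_ofCoeffs_nil, eval_derivative_ofCoeffs_cons,
    eval_derivative_ofCoeffs_nil, Nat.cast_one] at h ⊢
  -- The cofactor is the quotient of the difference of the two sides by `y² - fH7(x)`; the
  -- certificates below are of the same kind.
  linear_combination ((-5/2 + 70*x - 980*x^2 + 8736*x^3 - 50736*x^4 + 185024*x^5 - 396704*x^6 +
    439040*x^7 - 175616*x^8) + (58 - 1400*x + 13664*x^2 - 68096*x^3 + 180320*x^4 - 238336*x^5 +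
    125440*x^6)*y) * h

theorem deriv_pref₁ (x y : ℂ) (h : y ^ 2 = fH7.eval x) :
    2 * lin pref₂A pref₂B x y + lin pref₁A pref₁B x y * (2 * (2 : ℕ) * (derivative (wH7 * cH7)).eval
      x * y ^ 2 + (3 : ℕ) * ((wH7 * cH7)).eval x * fH7.derivative.eval x) = ((wH7 * cH7)).eval x *
      (2 * y ^ 2 * lin pref₁A.derivative (derivative pref₁B) x y + y * fH7.derivative.eval x *
      (pref₁B : ℂ[X]).eval x) := by
  simp only [lin, fH7, wH7, cH7, pref₁A, pref₁B, pref₂A, pref₂B, eval_mul, derivative_mul, eval_add,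
    eval_ofCoeffs_cons, eval_ofCoeffs_nil, eval_derivative_ofCoeffs_cons,
    eval_derivative_ofCoeffs_nil, Nat.cast_ofNat] at h ⊢
  linear_combination ((17 - 1161*x + 147021/4*x^2 - 1422995/2*x^3 + 9374337*x^4 - 88646880*x^5 +
    618232468*x^6 - 3213441168*x^7 + 12392022384*x^8 - 34577416832*x^9 + 65137115904*x^10 -
    64756336512*x^11 - 28079417856*x^12 + 200667973632*x^13 - 303708905472*x^14 + 221236822016*x^15
    - 66087813120*x^16) + (-58 + 3583*x - 103488*x^2 + 1834840*x^3 - 22157744*x^4 + 191890944*x^5 -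
    1225050176*x^6 + 5843471872*x^7 - 20890595712*x^8 + 55616796928*x^9 - 108378780160*x^10 +
    149664872448*x^11 - 138214006784*x^12 + 76237012992*x^13 - 18882232320*x^14)*y) * h

theorem deriv_ell (x y : ℂ) (h : y ^ 2 = fH7.eval x) :
    2 * lin ell₁A 0 x y + lin ellA 0 x y * (2 * (1 : ℕ) * (derivative cH7).eval x * y ^ 2 + (1 : ℕ)
      * (cH7).eval x * fH7.derivative.eval x) = (cH7).eval x * (2 * y ^ 2 * lin ellA.derivative
      (derivative 0) x y + y * fH7.derivative.eval x * (0 : ℂ[X]).eval x) := by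
  simp only [lin, fH7, cH7, ellA, ell₁A, eval_zero, derivative_zero, eval_ofCoeffs_cons,
    eval_ofCoeffs_nil, eval_derivative_ofCoeffs_cons, eval_derivative_ofCoeffs_nil, Nat.cast_one]
    at h ⊢
  linear_combination (98 - 1960*x + 18816*x^2 - 109760*x^3 + 373184*x^4 - 614656*x^5 +
    307328*x^6) * h

theorem deriv_ell₁ (x y : ℂ) (h : y ^ 2 = fH7.eval x) :
    2 * lin ell₂A 0 x y + lin ell₁A 0 x y * (2 * (2 : ℕ) * (derivative cH7).eval x * y ^ 2 + (3 : ℕ)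
      * (cH7).eval x * fH7.derivative.eval x) = (cH7).eval x * (2 * y ^ 2 * lin ell₁A.derivative
      (derivative 0) x y + y * fH7.derivative.eval x * (0 : ℂ[X]).eval x) := by
  simp only [lin, fH7, cH7, ell₁A, ell₂A, eval_zero, derivative_zero, eval_ofCoeffs_cons,
    eval_ofCoeffs_nil, eval_derivative_ofCoeffs_cons, eval_derivative_ofCoeffs_nil, Nat.cast_ofNat]
    at h ⊢
  linear_combination (539/2 - 13965*x + 328839*x^2 - 4569250*x^3 + 40892460*x^4 - 240604896*x^5 +
    887645584*x^6 - 1552621056*x^7 - 2396697408*x^8 + 22633477888*x^9 - 64797035520*x^10 +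
    100293419520*x^11 - 83367022592*x^12 + 28913418240*x^13) * h

theorem deriv_lam (x y : ℂ) (h : y ^ 2 = fH7.eval x) :
    2 * lin lam₁A lam₁B x y + lin lamA lamB x y * (2 * (1 : ℕ) * (derivative (wH7 * hH7)).eval x * y
      ^ 2 + (1 : ℕ) * ((wH7 * hH7)).eval x * fH7.derivative.eval x) = ((wH7 * hH7)).eval x * (2 * y
      ^ 2 * lin lamA.derivative (derivative lamB) x y + y * fH7.derivative.eval x * (lamB :
      ℂ[X]).eval x) := by
  simp only [lin, fH7, wH7, hH7, lamA, lamB, lam₁A, lam₁B, eval_mul, derivative_mul, eval_add,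
    eval_ofCoeffs_cons, eval_ofCoeffs_nil, eval_derivative_ofCoeffs_cons,
    eval_derivative_ofCoeffs_nil, Nat.cast_one] at h ⊢
  linear_combination ((-5 + 60*x - 2688*x^3 + 13440*x^4 - 26880*x^5 + 25088*x^6) + (96 - 2240*x +
    20288*x^2 - 82432*x^3 + 125440*x^4)*y) * h

theorem deriv_lam₁ (x y : ℂ) (h : y ^ 2 = fH7.eval x) :
    2 * lin lam₂A lam₂B x y + lin lam₁A lam₁B x y * (2 * (2 : ℕ) * (derivative (wH7 * hH7)).eval x *
      y ^ 2 + (3 : ℕ) * ((wH7 * hH7)).eval x * fH7.derivative.eval x) = ((wH7 * hH7)).eval x * (2 *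
      y ^ 2 * lin lam₁A.derivative (derivative lam₁B) x y + y * fH7.derivative.eval x * (lam₁B :
      ℂ[X]).eval x) := by
  simp only [lin, fH7, wH7, hH7, lam₁A, lam₁B, lam₂A, lam₂B, eval_mul, derivative_mul, eval_add,
    eval_ofCoeffs_cons, eval_ofCoeffs_nil, eval_derivative_ofCoeffs_cons,
    eval_derivative_ofCoeffs_nil, Nat.cast_ofNat] at h ⊢
  linear_combination ((34 - 2376*x + 77982*x^2 - 1559800*x^3 + 20965392*x^4 - 198617664*x^5 +
    1358247072*x^6 - 6760091520*x^7 + 24353774592*x^8 - 62180056064*x^9 + 107663947776*x^10 -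
    115911376896*x^11 + 63974801408*x^12 - 9441116160*x^13) + (-96 + 5584*x - 158352*x^2 +
    2790016*x^3 - 33085568*x^4 + 273313152*x^5 - 1593962496*x^6 + 6546140160*x^7 - 18546339840*x^8 +
    34545975296*x^9 - 38112886784*x^10 + 18882232320*x^11)*y) * h

/-- The same for the part with the square root, in the shape required by `hasDerivU_div_sqrt`. -/
theorem deriv_mu (x y : ℂ) (h : y ^ 2 = fH7.eval x) :
    2 * lin mu₁A mu₁B x y + lin muA muB x y * (2 * (1 : ℕ) * (derivative (wH7 * hH7)).eval x *
      qH7.eval x * y ^ 2 + (2 * (0 : ℕ) + 1) * (wH7 * hH7).eval x * qH7.derivative.eval x * y ^ 2 +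
      (1 : ℕ) * (wH7 * hH7).eval x * qH7.eval x * fH7.derivative.eval x + (wH7 * hH7).eval x *
      qH7.eval x * f₀H7.eval x) = (wH7 * hH7).eval x * qH7.eval x * (2 * y ^ 2 * lin muA.derivative
      muB.derivative x y + y * fH7.derivative.eval x * muB.eval x) := by
  simp only [lin, fH7, f₀H7, qH7, wH7, hH7, muA, muB, mu₁A, mu₁B, eval_mul, derivative_mul,
    eval_add, eval_ofCoeffs_cons, eval_ofCoeffs_nil, eval_derivative_ofCoeffs_cons,
    eval_derivative_ofCoeffs_nil, Nat.cast_zero, Nat.cast_one] at h ⊢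
  linear_combination ((10 - 865/2*x + 17317/2*x^2 - 105105*x^3 + 846832*x^4 - 4651920*x^5 +
    17250688*x^6 - 41272896*x^7 + 57388800*x^8 - 35123200*x^9) + (-41 + 1345*x - 19240*x^2 +
    157920*x^3 - 813344*x^4 + 2643648*x^5 - 5005056*x^6 + 4214784*x^7)*y) * h

theorem deriv_mu₁ (x y : ℂ) (h : y ^ 2 = fH7.eval x) :
    2 * lin mu₂A mu₂B x y + lin mu₁A mu₁B x y * (2 * (2 : ℕ) * (derivative (wH7 * hH7)).eval x *
      qH7.eval x * y ^ 2 + (2 * (1 : ℕ) + 1) * (wH7 * hH7).eval x * qH7.derivative.eval x * y ^ 2 +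
      (3 : ℕ) * (wH7 * hH7).eval x * qH7.eval x * fH7.derivative.eval x + (wH7 * hH7).eval x *
      qH7.eval x * f₀H7.eval x) = (wH7 * hH7).eval x * qH7.eval x * (2 * y ^ 2 * lin mu₁A.derivative
      mu₁B.derivative x y + y * fH7.derivative.eval x * mu₁B.eval x) := by
  simp only [lin, fH7, f₀H7, qH7, wH7, hH7, mu₁A, mu₁B, mu₂A, mu₂B, eval_mul, derivative_mul,
    eval_add, eval_ofCoeffs_cons, eval_ofCoeffs_nil, eval_derivative_ofCoeffs_cons,
    eval_derivative_ofCoeffs_nil, Nat.cast_one, Nat.cast_ofNat] at h ⊢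
  linear_combination ((-565*x + 390153/8*x^2 - 2010034*x^3 + 104721235/2*x^4 - 1925018739/2*x^5 +
    13214043563*x^6 - 139988767590*x^7 + 1166932345572*x^8 - 7739170352592*x^9 + 41031898643008*x^10
    - 173803755562752*x^11 + 584600899246336*x^12 - 1541949610320896*x^13 + 3122007039148032*x^14 -
    4685840165199872*x^15 + 4912904378482688*x^16 - 3212925122641920*x^17 + 986911342592000*x^18) +
    (104 - 32669/4*x + 627739/2*x^2 - 7764328*x^3 + 136922697*x^4 - 1807847132*x^5 + 18351062716*x^6
    - 145344351600*x^7 + 904862589568*x^8 - 4434911048064*x^9 + 17041162473216*x^10 -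
    50785568805888*x^11 + 115091728453632*x^12 - 191805774913536*x^13 + 221782911909888*x^14 -
    159033713491968*x^15 + 53293212499968*x^16)*y) * h

/-! ### Polynomial identities on the curve: the differential equation, coefficient by coefficient.
-/

/-- Coefficient of `F₂`, divided by `ℓ`: `3mℓ + 3ℓ' + (3/2)T - (5/14)ℓ² + aℓ = 0`. The constant is
`3/2 = 8/7 + 5/14`, from `(8/7 + (5/14)Ψ)T` with `ΨT = T - ℓ²`. -/
theorem ode_pref_two (x y : ℂ) (h : y ^ 2 = fH7.eval x) :
    3 * qH7.eval x * y * lin prefA prefB x y * lin ellA 0 x y + 3 * wH7.eval x * qH7.eval x * lin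
      ell₁A 0 x y + 3/2 * wH7.eval x * y * lin quoA quoB x y - 5/14 * wH7.eval x * qH7.eval x * y *
      lin ellA 0 x y ^ 2 + lin odeTwoA odeTwoB x y * lin ellA 0 x y = 0 := by
  simp only [lin, fH7, qH7, wH7, quoA, quoB, ellA, ell₁A, prefA, prefB, odeTwoA, odeTwoB, eval_zero,
    eval_ofCoeffs_cons, eval_ofCoeffs_nil] at h ⊢
  linear_combination (-1491/2 + 46893/2*x - 316932*x^2 + 2382576*x^3 - 10639860*x^4 + 26786928*x^5
    - 24086832*x^6 - 56010528*x^7 + 180708864*x^8 - 154893312*x^9) * h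

/-- Coefficient of `F₁`: `3m²ℓ + 3m'ℓ + 3mℓ' + ℓ'' - ℓT/4 + ℓ³/196 + a(2mℓ + ℓ') + bwℓ = 0`, where
`1/4 = 12/49 + 1/196`. -/
theorem ode_pref_one (x y : ℂ) (h : y ^ 2 = fH7.eval x) :
    3 * qH7.eval x * y^2 * lin prefA prefB x y ^ 2 * lin ellA 0 x y + 3 * qH7.eval x * y * lin pref₁A
      pref₁B x y * lin ellA 0 x y + 3 * qH7.eval x * y * wH7.eval x * lin prefA prefB x y * lin
      ell₁A 0 x y + wH7.eval x ^ 2 * qH7.eval x * lin ell₂A 0 x y - 1/4 * wH7.eval x ^ 2 * y^2 * lin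
      ellA 0 x y * lin quoA quoB x y + 1/196 * wH7.eval x ^ 2 * qH7.eval x * y^2 * lin ellA 0 x y ^ 3 +
      2 * y * lin odeTwoA odeTwoB x y * lin prefA prefB x y * lin ellA 0 x y + wH7.eval x * lin
      odeTwoA odeTwoB x y * lin ell₁A 0 x y + lin odeOneA odeOneB x y * lin ellA 0 x y = 0 := by
  simp only [lin, fH7, qH7, wH7, quoA, quoB, ellA, ell₁A, ell₂A, prefA, prefB, pref₁A, pref₁B,
    odeOneA, odeOneB, odeTwoA, odeTwoB, eval_zero, eval_ofCoeffs_cons, eval_ofCoeffs_nil] at h ⊢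
  linear_combination ((679/4 - 37933/8*x - 120589/4*x^2 + 14174083/4*x^3 - 163004919/2*x^4 +
    1089674495*x^5 - 9999247818*x^6 + 67188583812*x^7 - 340675708520*x^8 + 1317841864080*x^9 -
    3868872056224*x^10 + 8392217681792*x^11 - 12515736724736*x^12 + 10035486053376*x^13 +
    3055304999936*x^14 - 18312313442304*x^15 + 19915562483712*x^16 - 8095757107200*x^17) + (4095/4 -
    86541/2*x + 3165645/4*x^2 - 15863211/2*x^3 + 42889553*x^4 - 57624000*x^5 - 901114508*x^6 +
    7426465872*x^7 - 28038109680*x^8 + 50673777280*x^9 + 17462069632*x^10 - 324538060672*x^11 +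
    783131980288*x^12 - 890533281792*x^13 + 418280783872*x^14)*y + (-2541/2 + 218295/4*x -
    4023243/4*x^2 + 20177073/2*x^3 - 54649161*x^4 + 82820094*x^5 + 990750012*x^6 - 8398294632*x^7 +
    33627868176*x^8 - 81204432288*x^9 + 120132671232*x^10 - 100293419520*x^11 +
    36141772800*x^12)*y^2) * h

/-- Coefficient of `F₀`, with `a` and `b` already fixed by the other two: `m'' + 3mm' + m³ + a(m' +
m²) + b(wm - 4) - (5/2744)ℓ(T - ℓ²) = 0`. -/
theorem ode_pref_zero (x y : ℂ) (h : y ^ 2 = fH7.eval x) :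
    qH7.eval x * lin pref₂A pref₂B x y + 3 * qH7.eval x * y * lin prefA prefB x y * lin pref₁A
      pref₁B x y + qH7.eval x * y^2 * lin prefA prefB x y ^ 3 + lin odeTwoA odeTwoB x y * (lin pref₁A
      pref₁B x y + y * lin prefA prefB x y ^ 2) + lin odeOneA odeOneB x y * lin prefA prefB x y - 4 *
      cH7.eval x * y * lin odeOneA odeOneB x y - 5/2744 * wH7.eval x ^ 3 * y^2 * lin ellA 0 x y * (lin
      quoA quoB x y - qH7.eval x * lin ellA 0 x y ^ 2) = 0 := by
  simp only [lin, fH7, cH7, qH7, wH7, quoA, quoB, ellA, prefA, prefB, pref₁A, pref₁B, pref₂A,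
    pref₂B, odeOneA, odeOneB, odeTwoA, odeTwoB, eval_zero, eval_ofCoeffs_cons, eval_ofCoeffs_nil]
    at h ⊢
  linear_combination ((79/8 - 3273/8*x + 74177/16*x^2 + 1242661/16*x^3 - 27949285/8*x^4 +
    246455419/4*x^5 - 1394527155/2*x^6 + 5677496671*x^7 - 34860699650*x^8 + 164874391892*x^9 -
    604607096072*x^10 + 1710081303168*x^11 - 3660705883072*x^12 + 5690805483776*x^13 -
    5843606506752*x^14 + 2848473255936*x^15 + 1231505092608*x^16 - 2622033985536*x^17 +
    1156536729600*x^18) + (-585/8 + 34627/8*x - 3756117/32*x^2 + 30751959/16*x^3 - 168191891/8*x^4 +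
    319054113/2*x^5 - 1661157869/2*x^6 + 2658835256*x^7 - 2002081690*x^8 - 29907769752*x^9 +
    190487080560*x^10 - 651382096624*x^11 + 1475157496960*x^12 - 2277416649984*x^13 +
    2318157893632*x^14 - 1406431272960*x^15 + 385512243200*x^16)*y + (-1331/8 + 124993/16*x -
    2564793/16*x^2 + 14783769/8*x^3 - 49763637/4*x^4 + 78942479/2*x^5 + 86359119*x^6 -
    1618740970*x^7 + 8802756116*x^8 - 28248511368*x^9 + 58267314336*x^10 - 76060299392*x^11 +
    57267499520*x^12 - 18931404800*x^13)*y^2 + (1331/4 - 129591/8*x + 705397/2*x^2 - 9052519/2*x^3 +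
    37968630*x^4 - 218119874*x^5 + 873447736*x^6 - 2431345896*x^7 + 4597198816*x^8 - 5608077440*x^9
    + 3964531200*x^10 - 1229312000*x^11)*y^3) * h

/-- The part free of the square root in the equation for `λ`. Products of two terms with `1/y`
contribute here through `1/y² = 1/(u q)`. -/
theorem ode_lam_one (x y : ℂ) (h : y ^ 2 = fH7.eval x) :
    cH7.eval x ^ 2 * qH7.eval x ^ 2 * x * lin lam₂A lam₂B x y + 3 * (cH7.eval x ^ 2 * qH7.eval x ^ 2 * x * y
      * lin lamA lamB x y * lin lam₁A lam₁B x y + cH7.eval x ^ 2 * y * lin muA muB x y * lin mu₁A mu₁B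
      x y) + cH7.eval x ^ 2 * qH7.eval x ^ 2 * x * y^2 * lin lamA lamB x y ^ 3 + 3 * cH7.eval x ^ 2 *
      qH7.eval x * y^2 * lin lamA lamB x y * lin muA muB x y ^ 2 + lin odeTwoA odeTwoB x y * (hH7.eval
      x * cH7.eval x * qH7.eval x * x * lin lam₁A lam₁B x y + hH7.eval x * cH7.eval x * qH7.eval x *
      x * y * lin lamA lamB x y ^ 2 + hH7.eval x * cH7.eval x * y * lin muA muB x y ^ 2) + hH7.eval x ^ 2
      * qH7.eval x * x * lin odeOneA odeOneB x y * lin lamA lamB x y - 4 * hH7.eval x ^ 3 * qH7.eval x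
      * x * y * lin odeOneA odeOneB x y = 0 := by
  simp only [lin, fH7, cH7, hH7, qH7, lamA, lamB, lam₁A, lam₁B, lam₂A, lam₂B, muA, muB, mu₁A, mu₁B,
    odeOneA, odeOneB, odeTwoA, odeTwoB, eval_ofCoeffs_cons, eval_ofCoeffs_nil] at h ⊢
  linear_combination ((79/2*x - 12377/4*x^2 + 199093/2*x^3 - 10592579/8*x^4 - 26664701/2*x^5 +
    3993954307/4*x^6 - 48441294461/2*x^7 + 384481179103*x^8 - 4546545320702*x^9 +
    42189191658404*x^10 - 315525031218600*x^11 + 1930376766973648*x^12 - 9737942068348256*x^13 +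
    40627361021481472*x^14 - 140035503047482112*x^15 + 396794604556851200*x^16 -
    915725058986694656*x^17 + 1696166865946083328*x^18 - 2466532881817518080*x^19 +
    2723337334233169920*x^20 - 2165515687381172224*x^21 + 1132035915336646656*x^22 -
    323084179313000448*x^23 + 29015193472204800*x^24) + (-537/4*x + 109885/8*x^2 - 660735*x^3 +
    39642069/2*x^4 - 414609316*x^5 + 6401819438*x^6 - 75251434608*x^7 + 682860622752*x^8 -
    4774159997376*x^9 + 25042880749824*x^10 - 89866060368000*x^11 + 133288602995072*x^12 +
    798036043069440*x^13 - 7490914462897152*x^14 + 34785857865629696*x^15 - 111484511880978432*x^16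
    + 262968025897041920*x^17 - 459886661813927936*x^18 + 583236238582480896*x^19 -
    508440501348204544*x^20 + 272642647137452032*x^21 - 67702118101811200*x^22)*y + (-17/2 -
    1347/4*x + 65409*x^2 - 3186305*x^3 + 87390169*x^4 - 1602859762*x^5 + 21167720532*x^6 -
    208994643816*x^7 + 1570800502432*x^8 - 9016568462720*x^9 + 38988682524736*x^10 -
    121404775250304*x^11 + 235345731199488*x^12 - 74004490728448*x^13 - 1226024701698048*x^14 +
    4572454327017472*x^15 - 9009863361200128*x^16 + 10816441472843776*x^17 - 7475329123483648*x^18 +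
    2288400675635200*x^19)*y^2 + (42 - 2057*x + 9644*x^2 + 1877842*x^3 - 75012760*x^4 +
    1582265608*x^5 - 22374756320*x^6 + 229824639296*x^7 - 1779756932352*x^8 + 10581047111040*x^9 -
    48618364555264*x^10 + 172279323044864*x^11 - 465741270593536*x^12 + 940520549785600*x^13 -
    1368598832283648*x^14 + 1349340214132736*x^15 - 802328080547840*x^16 +
    215886856192000*x^17)*y^3) * h

/-- The coefficient of `1/y` in the equation for `λ`. The constant `-4b` does not occur in it. -/
theorem ode_lam_sqrt (x y : ℂ) (h : y ^ 2 = fH7.eval x) :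
    cH7.eval x ^ 2 * x * lin mu₂A mu₂B x y + 3 * (cH7.eval x ^ 2 * qH7.eval x * x * y * lin lamA lamB x
      y * lin mu₁A mu₁B x y + cH7.eval x ^ 2 * qH7.eval x ^ 2 * x * y * lin muA muB x y * lin lam₁A
      lam₁B x y) + 3 * cH7.eval x ^ 2 * qH7.eval x ^ 2 * x * y^2 * lin lamA lamB x y ^ 2 * lin muA muB x y
      + cH7.eval x ^ 2 * qH7.eval x * y^2 * lin muA muB x y ^ 3 + lin odeTwoA odeTwoB x y * (hH7.eval x
      * cH7.eval x * x * lin mu₁A mu₁B x y + 2 * hH7.eval x * cH7.eval x * qH7.eval x * x * y * lin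
      lamA lamB x y * lin muA muB x y) + hH7.eval x ^ 2 * qH7.eval x * x * lin odeOneA odeOneB x y *
      lin muA muB x y = 0 := by
  simp only [lin, fH7, cH7, hH7, qH7, lamA, lamB, lam₁A, lam₁B, muA, muB, mu₁A, mu₁B, mu₂A, mu₂B,
    odeOneA, odeOneB, odeTwoA, odeTwoB, eval_ofCoeffs_cons, eval_ofCoeffs_nil] at h ⊢
  linear_combination ((-2415/8*x^2 + 470615/16*x^3 - 10748185/8*x^4 + 304906697/8*x^5 -
    1497119097/2*x^6 + 42820097887/4*x^7 - 226589882575/2*x^8 + 866899119681*x^9 -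
    4207158983174*x^10 + 2788772580468*x^11 + 174604862652472*x^12 - 2008196420734448*x^13 +
    14159004404842976*x^14 - 74469918397818496*x^15 + 309083662089214208*x^16 -
    1033518367364267008*x^17 + 2799873916638840832*x^18 - 6121772885836324864*x^19 +
    10672863936223526912*x^20 - 14517435991054352384*x^21 + 14863259660699828224*x^22 -
    10779387401842196480*x^23 + 4937176962574581760*x^24 - 1073562158471577600*x^25) + (18*x -
    3529/2*x^2 + 321381/4*x^3 - 8908027/4*x^4 + 164093113/4*x^5 - 502005805*x^6 + 3427836944*x^7 +
    6665923460*x^8 - 524218399684*x^9 + 7874402547200*x^10 - 76806082651088*x^11 +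
    561048061381248*x^12 - 3218314148866880*x^13 + 14782820197858048*x^14 - 54751194381753856*x^15 +
    163360315051874304*x^16 - 389771814384103424*x^17 + 733131069606182912*x^18 -
    1062077411148070912*x^19 + 1141989085852073984*x^20 - 856910754398863360*x^21 +
    399708469407514624*x^22 - 87045580416614400*x^23)*y + (253*x - 43349/2*x^2 + 853092*x^3 -
    40573187/2*x^4 + 320494234*x^5 - 3431034096*x^6 + 23041034016*x^7 - 49830198376*x^8 -
    885866965536*x^9 + 13155356026400*x^10 - 103982373904640*x^11 + 576387311135104*x^12 -
    2395405764261888*x^13 + 7613855784700928*x^14 - 18498113674055680*x^15 + 33822431246098432*x^16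
    - 45060437732753408*x^17 + 41246154264870912*x^18 - 23145260693323776*x^19 +
    5984383653642240*x^20)*y^2 + (-2 - 421*x + 46509*x^2 - 2081614*x^3 + 56158142*x^4 -
    1042549424*x^5 + 14214708760*x^6 - 147694652000*x^7 + 1195195333696*x^8 - 7625140704384*x^9 +
    38547513459840*x^10 - 154257491813376*x^11 + 485202194512896*x^12 - 1182771201626112*x^13 +
    2182724511916032*x^14 - 2936711107706880*x^15 + 2705294716895232*x^16 - 1517468712173568*x^17 +
    388596341145600*x^18)*y^3) * h

/-! ### The factors of `Ψ₇` and the radicands: logarithmic derivatives and norms. -/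

/-- `P₇ = pSevenA + v pSevenB`. -/
noncomputable def pSevenA : ℂ[X] := ofCoeffs [0, 7/2, -35, 112, -128]

noncomputable def pSevenB : ℂ[X] := ofCoeffs [1]

/-- The logarithmic derivative of `P₇` is `(logPSevenA + v logPSevenB) / (w v²)`. -/
noncomputable def logPSevenA : ℂ[X] := ofCoeffs [-1/2, 191/8, -595/2, 3143/2, -3808, 3584]

noncomputable def logPSevenB : ℂ[X] := ofCoeffs [-7/4, 21/2]

/-- `2v - 3u + 14u² = facPosA + v facPosB`. -/
noncomputable def facPosA : ℂ[X] := ofCoeffs [0, -3, 14]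

noncomputable def facPosB : ℂ[X] := ofCoeffs [2]

/-- Numerator of the logarithmic derivative of `2v - 3u + 14u²`, over `w c v²`. -/
noncomputable def logFacPosA : ℂ[X] := ofCoeffs [-1/2, 207/8, -497, 9919/2, -28938, 102620, -217952,
  254800, -125440]

noncomputable def logFacPosB : ℂ[X] := ofCoeffs [3/4, -21/2, 42, 28, -504, 784]

/-- `-2v - 3u + 14u² = facNegA + v facNegB`. -/
noncomputable def facNegA : ℂ[X] := ofCoeffs [0, -3, 14]

noncomputable def facNegB : ℂ[X] := ofCoeffs [-2]

noncomputable def logFacNegA : ℂ[X] := ofCoeffs [-1/2, 207/8, -497, 9919/2, -28938, 102620, -217952,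
  254800, -125440]

noncomputable def logFacNegB : ℂ[X] := ofCoeffs [-3/4, 21/2, -42, -28, 504, -784]

/-- The seventh power of `2v - 3u + 14u²`. -/
noncomputable def powPosA : ℂ[X] := ofCoeffs [0, 0, 0, 0, -1344, 54656, -995904, 10757184,
  -77151872, 394571520, -1549510144, 5160651776, -15884818432, 44293165056, -99662782464,
  159082807296, -156093120512, 70493667328]

noncomputable def powPosB : ℂ[X] := ofCoeffs [0, 0, 0, 128, 0, -94080, 2050944, -22417920,
  154065408, -722835456, 2390083584, -5547057152, 8600969216, -7710244864, 2157969408, 1438646272]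

noncomputable def powNegA : ℂ[X] := ofCoeffs [0, 0, 0, 0, -1344, 54656, -995904, 10757184,
  -77151872, 394571520, -1549510144, 5160651776, -15884818432, 44293165056, -99662782464,
  159082807296, -156093120512, 70493667328]

noncomputable def powNegB : ℂ[X] := ofCoeffs [0, 0, 0, -128, 0, 94080, -2050944, 22417920,
  -154065408, 722835456, -2390083584, 5547057152, -8600969216, 7710244864, -2157969408, -1438646272]

/-- `P₁ = polyP1A + v polyP1B`. -/
noncomputable def polyP1A : ℂ[X] := ofCoeffs [-11/8, 53/2, -204, 784, -1540, 1344]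

noncomputable def polyP1B : ℂ[X] := ofCoeffs [-3, 30, -84]

noncomputable def polyQ1A : ℂ[X] := ofCoeffs [0, 5/2, -25, 84, -112]

noncomputable def polyQ1B : ℂ[X] := ofCoeffs [1, -4, 16]

/-- The product of `W₊⁴` and `W₋⁴`. -/
noncomputable def normWA : ℂ[X] := ofCoeffs [-7/64, -63/8, 238, -2394, 9289, 12096, -265104,
  1139712, -2483936, 2860032, -1404928]

noncomputable def normWB : ℂ[X] := ofCoeffs [-7/4, 7/2, 399, -4676, 22680, -54768, 63392, -25088]

theorem log_pSeven (x y : ℂ) (h : y ^ 2 = fH7.eval x) :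
    2 * (lin pSevenA pSevenB x y * lin logPSevenA logPSevenB x y) = wH7.eval x * y * (2 * y * lin
      pSevenA.derivative pSevenB.derivative x y + fH7.derivative.eval x * pSevenB.eval x) := by
  simp only [lin, fH7, wH7, pSevenA, pSevenB, logPSevenA, logPSevenB, eval_ofCoeffs_cons,
    eval_ofCoeffs_nil, eval_derivative_ofCoeffs_cons, eval_derivative_ofCoeffs_nil] at h ⊢
  linear_combination (7/2 - 147*x + 1232*x^2 - 3712*x^3 + 4096*x^4) * h

theorem log_facPos (x y : ℂ) (h : y ^ 2 = fH7.eval x) :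
    2 * (lin facPosA facPosB x y * lin logFacPosA logFacPosB x y) = (wH7 * cH7).eval x * y * (2 * y
      * lin facPosA.derivative facPosB.derivative x y + fH7.derivative.eval x * facPosB.eval x) := by
  simp only [lin, fH7, wH7, cH7, facPosA, facPosB, logFacPosA, logFacPosB, eval_mul,
    eval_ofCoeffs_cons, eval_ofCoeffs_nil, eval_derivative_ofCoeffs_cons,
    eval_derivative_ofCoeffs_nil] at h ⊢
  linear_combination (-3 + 122*x - 1512*x^2 + 8064*x^3 - 19040*x^4 + 15680*x^5) * h

theorem log_facNeg (x y : ℂ) (h : y ^ 2 = fH7.eval x) :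
    2 * (lin facNegA facNegB x y * lin logFacNegA logFacNegB x y) = (wH7 * cH7).eval x * y * (2 * y
      * lin facNegA.derivative facNegB.derivative x y + fH7.derivative.eval x * facNegB.eval x) := by
  simp only [lin, fH7, wH7, cH7, facNegA, facNegB, logFacNegA, logFacNegB, eval_mul,
    eval_ofCoeffs_cons, eval_ofCoeffs_nil, eval_derivative_ofCoeffs_cons,
    eval_derivative_ofCoeffs_nil] at h ⊢
  linear_combination (-3 + 122*x - 1512*x^2 + 8064*x^3 - 19040*x^4 + 15680*x^5) * h

/-- The two factors are conjugate under `v ↦ -v`; their norm shows that neither vanishes at a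
generic point. -/
theorem facPos_mul_facNeg (x y : ℂ) (h : y ^ 2 = fH7.eval x) :
    lin facPosA facPosB x y * lin facNegA facNegB x y = 4 * x * wH7.eval x * cH7.eval x := by
  simp only [lin, fH7, cH7, wH7, facPosA, facPosB, facNegA, facNegB, eval_ofCoeffs_cons,
    eval_ofCoeffs_nil] at h ⊢
  linear_combination (-4) * h

theorem pSeven_mul_conj (x y : ℂ) (h : y ^ 2 = fH7.eval x) :
    lin pSevenA pSevenB x y * (lin pSevenA pSevenB x y - 2 * y) = 1 * x * wH7.eval x ^ 7 := by
  simp only [lin, fH7, wH7, pSevenA, pSevenB, eval_ofCoeffs_cons, eval_ofCoeffs_nil] at h ⊢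
  linear_combination (-1) * h

/-- Reducing the seventh power to the form `A + vB` beforehand lowers the degree in `y` of the
certificate of `quo_identity`. -/
theorem facPos_pow (x y : ℂ) (h : y ^ 2 = fH7.eval x) :
    lin facPosA facPosB x y ^ 7 = lin powPosA powPosB x y := by
  simp only [lin, fH7, facPosA, facPosB, powPosA, powPosB, eval_ofCoeffs_cons, eval_ofCoeffs_nil]
    at h ⊢
  linear_combination ((-1344*x^3 + 33488*x^4 - 346164*x^5 + 1949416*x^6 - 6982304*x^7 + 20738368*x^8
    - 67414592*x^9 + 198402176*x^10 - 372305920*x^11 + 314703872*x^12) + (128*x^2 + 2016*x^3 -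
    73976*x^4 + 721728*x^5 - 3596096*x^6 + 10875648*x^7 - 20264832*x^8 + 16257024*x^9 +
    6422528*x^10)*y + (-1344*x^2 + 12320*x^3 - 9408*x^4 - 106624*x^5 - 213248*x^6 + 1404928*x^7)*y^2
    + (128*x + 4032*x^2 - 44800*x^3 + 102144*x^4 + 28672*x^5)*y^3 + (-1344*x + 6272*x^2)*y^4 +
    (128)*y^5) * h

theorem facNeg_pow (x y : ℂ) (h : y ^ 2 = fH7.eval x) :
    lin facNegA facNegB x y ^ 7 = lin powNegA powNegB x y := by
  simp only [lin, fH7, facNegA, facNegB, powNegA, powNegB, eval_ofCoeffs_cons, eval_ofCoeffs_nil]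
    at h ⊢
  linear_combination ((-1344*x^3 + 33488*x^4 - 346164*x^5 + 1949416*x^6 - 6982304*x^7 + 20738368*x^8
    - 67414592*x^9 + 198402176*x^10 - 372305920*x^11 + 314703872*x^12) + (-128*x^2 - 2016*x^3 +
    73976*x^4 - 721728*x^5 + 3596096*x^6 - 10875648*x^7 + 20264832*x^8 - 16257024*x^9 -
    6422528*x^10)*y + (-1344*x^2 + 12320*x^3 - 9408*x^4 - 106624*x^5 - 213248*x^6 + 1404928*x^7)*y^2
    + (-128*x - 4032*x^2 + 44800*x^3 - 102144*x^4 - 28672*x^5)*y^3 + (-1344*x + 6272*x^2)*y^4 +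
    (-128)*y^5) * h

/-- The sum `2P₇'/P₇ + 7(log(2v - 3u + 14u²))' - 1/u - 28/w - 7(log(-2v - 3u + 14u²))'` over the
common denominator `w c v²`, with `1/u = f₀/v²`. The factor `w v` cancels, which leaves `ellA/(c
v)`. -/
theorem log_psi (x y : ℂ) (h : y ^ 2 = fH7.eval x) :
    2 * cH7.eval x * lin logPSevenA logPSevenB x y + 7 * lin logFacPosA logFacPosB x y - wH7.eval x
      * cH7.eval x * f₀H7.eval x - 28 * cH7.eval x * y^2 - 7 * lin logFacNegA logFacNegB x y =
      wH7.eval x * y * lin ellA 0 x y := by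
  simp only [lin, fH7, cH7, f₀H7, wH7, logFacPosA, logFacPosB, logFacNegA, logFacNegB, logPSevenA,
    logPSevenB, ellA, eval_zero, eval_ofCoeffs_cons, eval_ofCoeffs_nil] at h ⊢
  linear_combination (-28 + 392*x - 1568*x^2 + 1568*x^3) * h

/-- The exponents `1/2`, `1/14`, `-2/7` weight the logarithmic derivatives of the radicands; that of
`2v + 3u - 14u²` is the one of its negative, `-2v - 3u + 14u²`. -/
theorem log_prefactor (x y : ℂ) (h : y ^ 2 = fH7.eval x) :
    1 / 2 * lin logFacNegA logFacNegB x y + 1 / 14 * cH7.eval x * lin logPSevenA logPSevenB x y - 2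
      / 7 * wH7.eval x * cH7.eval x * f₀H7.eval x = y * lin prefA prefB x y := by
  simp only [lin, fH7, cH7, f₀H7, wH7, logFacNegA, logFacNegB, logPSevenA, logPSevenB, prefA, prefB,
    eval_ofCoeffs_cons, eval_ofCoeffs_nil] at h ⊢
  linear_combination (-11/2 + 70*x - 266*x^2 + 280*x^3) * h

/-- The relation `T(1 - Ψ) = ℓ²` multiplied by the denominator of `Ψ`. -/
theorem quo_identity (x y : ℂ) (h : y ^ 2 = fH7.eval x) :
    lin quoA quoB x y * (x * (1 - 4 * x)^7 * lin powNegA powNegB x y - lin pSevenA pSevenB x y ^ 2 *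
      lin powPosA powPosB x y) = lin ellA 0 x y ^ 2 * x * (1 - 4 * x)^7 * lin powNegA powNegB x y *
      qH7.eval x := by
  simp only [lin, fH7, qH7, powPosA, powPosB, powNegA, powNegB, pSevenA, pSevenB, quoA, quoB, ellA,
    eval_zero, eval_ofCoeffs_cons, eval_ofCoeffs_nil] at h ⊢
  linear_combination ((-65856*x^4 + 4291616*x^5 - 127321600*x^6 + 2249214464*x^7 - 25737413856*x^8 +
    189190425312*x^9 - 727615712544*x^10 - 1289582555072*x^11 + 38639048827904*x^12 -
    275770236990976*x^13 + 1096797692157440*x^14 - 1936274636004352*x^15 - 6158879024062464*x^16 +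
    67915542498549760*x^17 - 352208699238473728*x^18 + 1437023076302241792*x^19 -
    5050101979877212160*x^20 + 15046208643822125056*x^21 - 36299405656726044672*x^22 +
    67774781515755159552*x^23 - 93543678070682025984*x^24 + 89669424362305880064*x^25 -
    53343852894779080704*x^26 + 14861968965709594624*x^27) + (-6272*x^3 + 307328*x^4 - 16595712*x^5
    + 835932160*x^6 - 27703906944*x^7 + 617186846080*x^8 - 9891588015232*x^9 + 120105888211456*x^10
    - 1145171137797120*x^11 + 8788436418707456*x^12 - 55212355815192576*x^13 +
    287124138361274368*x^14 - 1243881794652012544*x^15 + 4498570504439431168*x^16 -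
    13551758262435807232*x^17 + 33764780254340710400*x^18 - 68656686725134548992*x^19 +
    111394062570324230144*x^20 - 138782481656196890624*x^21 + 123524870234129301504*x^22 -
    65849871051098423296*x^23 + 6617011588647878656*x^24 + 14026331393710096384*x^25 -
    4753849298486034432*x^26 - 1584616432828678144*x^27)*y + (-43904*x^3 + 1229312*x^4 +
    17210368*x^5 - 1500682624*x^6 + 37980516224*x^7 - 586251824256*x^8 + 6415435735296*x^9 -
    53099656096256*x^10 + 344097368538112*x^11 - 1779867138617344*x^12 + 7419178301480960*x^13 -
    24966399327027200*x^14 + 67426230120087552*x^15 - 143920513920827392*x^16 +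
    235698307239313408*x^17 - 279779326886019072*x^18 + 211944978084790272*x^19 -
    63253121769406464*x^20 - 35495253347663872*x^21 + 23985893270355968*x^22 +
    6189907940737024*x^23)*y^2) * h

/-- The part without `g` in `(P₁ + Q₁ g)' = 4λ(P₁ + Q₁ g)`, where `g² = q/u` and `y = u g`. The next
identity is the coefficient of `g`. -/
theorem log_W_one (x y : ℂ) (h : y ^ 2 = fH7.eval x) :
    x * wH7.eval x * hH7.eval x * (2 * y * lin polyP1A.derivative polyP1B.derivative x y +
      fH7.derivative.eval x * polyP1B.eval x) = 8 * (x * lin lamA lamB x y * lin polyP1A polyP1B x y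
      + lin muA muB x y * lin polyQ1A polyQ1B x y) := by
  simp only [lin, fH7, hH7, wH7, lamA, lamB, muA, muB, polyP1A, polyP1B, polyQ1A, polyQ1B,
    eval_ofCoeffs_cons, eval_ofCoeffs_nil, eval_derivative_ofCoeffs_cons,
    eval_derivative_ofCoeffs_nil] at h ⊢
  linear_combination (8 - 44*x - 1072*x^2 + 13632*x^3 - 59136*x^4 + 91392*x^5) * h

theorem log_W_sqrt (x y : ℂ) (h : y ^ 2 = fH7.eval x) :
    x * qH7.eval x * wH7.eval x * hH7.eval x * (2 * y * lin polyQ1A.derivative polyQ1B.derivative x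
      y + fH7.derivative.eval x * polyQ1B.eval x) + wH7.eval x * hH7.eval x * y * lin polyQ1A
      polyQ1B x y * (x * qH7.derivative.eval x - qH7.eval x) = 8 * x * (qH7.eval x * lin lamA lamB x
      y * lin polyQ1A polyQ1B x y + lin muA muB x y * lin polyP1A polyP1B x y) := by
  simp only [lin, fH7, hH7, qH7, wH7, lamA, lamB, muA, muB, polyQ1A, polyQ1B, polyP1A, polyP1B,
    eval_ofCoeffs_cons, eval_ofCoeffs_nil, eval_derivative_ofCoeffs_cons,
    eval_derivative_ofCoeffs_nil] at h ⊢
  linear_combination (2 - 168*x + 3456*x^2 - 32816*x^3 + 172192*x^4 - 541184*x^5 + 1037568*x^6 -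
    1003520*x^7) * h

theorem normW_eq (x y : ℂ) (h : y ^ 2 = fH7.eval x) :
    x * lin polyP1A polyP1B x y ^ 2 - qH7.eval x * lin polyQ1A polyQ1B x y ^ 2 = x * lin normWA normWB x
      y := by
  simp only [lin, fH7, qH7, normWA, normWB, polyP1A, polyP1B, polyQ1A, polyQ1B, eval_ofCoeffs_cons,
    eval_ofCoeffs_nil] at h ⊢
  linear_combination (-2 + 46*x - 500*x^2 + 3116*x^3 - 10928*x^4 + 19600*x^5 - 14336*x^6) * h

/-- Together with `normW_eq`, this confines the zeros of the radicands of `W±` to those of `w` and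
`h` when `u ≠ 0`. -/
theorem normW_mul_conj (x y : ℂ) (h : y ^ 2 = fH7.eval x) :
    lin normWA normWB x y * (normWA.eval x - y * normWB.eval x) = 49/4096 * wH7.eval x ^ 12 *
      hH7.eval x ^ 4 := by
  simp only [lin, fH7, wH7, hH7, normWA, normWB, eval_ofCoeffs_cons, eval_ofCoeffs_nil] at h ⊢
  linear_combination (-49/16 + 49/4*x + 5537/4*x^2 - 19159*x^3 - 47089*x^4 + 3381000*x^5 -
    39358368*x^6 + 255276672*x^7 - 1076983936*x^8 + 3097138688*x^9 - 6109617920*x^10 +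
    8081697792*x^11 - 6766584832*x^12 + 3180756992*x^13 - 629407744*x^14) * h

/-! ### The differential equation -/

/-- The coefficients of the common differential equation. -/
noncomputable def odeCoeff : Fin 4 → ℂ[X][X] :=
  ![C (-4 * odeOneA) + X * C (-4 * odeOneB), C (wH7 * odeOneA) + X * C (wH7 * odeOneB),
    C (wH7 ^ 2 * cH7 * fH7 * odeTwoA) + X * C (wH7 ^ 2 * cH7 * fH7 * odeTwoB),
    C (wH7 ^ 3 * cH7 ^ 2 * qH7 * fH7 ^ 2)]

theorem sum_odeCoeff (x y : ℂ) (F : ℕ → ℂ) :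
    ∑ k : Fin 4, (odeCoeff k).evalEval x y * F k =
      -4 * lin odeOneA odeOneB x y * F 0 + wH7.eval x * lin odeOneA odeOneB x y * F 1
      + wH7.eval x ^ 2 * cH7.eval x * fH7.eval x * lin odeTwoA odeTwoB x y * F 2
      + wH7.eval x ^ 3 * cH7.eval x ^ 2 * qH7.eval x * fH7.eval x ^ 2 * F 3 := by
  rw [Fin.sum_univ_four]
  simp [odeCoeff, evalEval, lin]
  ring

theorem odeCoeff_three_ne_zero :
    ∃ p ∈ curveH7, (odeCoeff 3).evalEval p.1 p.2 ≠ 0 := by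
  obtain ⟨y, hy⟩ := IsAlgClosed.exists_pow_nat_eq
    ((1 : ℂ) * (1 - 63 / 4 * 1 + 91 * 1 ^ 2 - 231 * 1 ^ 3 + 224 * 1 ^ 4)) two_pos
  refine ⟨(1, y), hy, ?_⟩
  simp [odeCoeff, evalEval, wH7, cH7, qH7, fH7, ofCoeffs]
  norm_num

theorem differentiableOn_iterate_derivU {Ω : Set ℂ} {u v W : ℂ → ℂ} (hp : IsParamH7 Ω u v)
    (hW : DifferentiableOn ℂ W Ω) (k : ℕ) : DifferentiableOn ℂ ((derivU u)^[k] W) Ω := by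
  induction k with
  | zero => exact hW
  | succ k ih =>
    rw [Function.iterate_succ_apply']
    exact (ih.deriv hp.isOpen).div (hp.differentiableOn_u.deriv hp.isOpen) hp.deriv_ne_zero

/-- An equation that holds on a nonempty open subset holds everywhere. -/
theorem satisfiesODE_of_subset {Ω V : Set ℂ} {u v W : ℂ → ℂ} (hp : IsParamH7 Ω u v)
    (hW : DifferentiableOn ℂ W Ω) (hV : IsOpen V) (hne : V.Nonempty) (hVΩ : V ⊆ Ω)
    (h : SatisfiesODE odeCoeff V u v W) : SatisfiesODE odeCoeff Ω u v W := by
  set E : ℂ → ℂ := fun t =>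
    ∑ k : Fin 4, (odeCoeff k).evalEval (u t) (v t) * ((derivU u)^[(k : ℕ)] W) t with hE
  have hdiff : DifferentiableOn ℂ E Ω := by
    have hev : ∀ A : ℂ[X], DifferentiableOn ℂ (fun t => A.eval (u t)) Ω := fun A =>
      A.differentiable.comp_differentiableOn hp.differentiableOn_u
    have hl : ∀ A B : ℂ[X], DifferentiableOn ℂ (fun t => lin A B (u t) (v t)) Ω := fun A B =>
      (hev A).add (hp.differentiableOn_v.mul (hev B))
    have hd := differentiableOn_iterate_derivU hp hW
    have hE' : E = fun t =>
        -4 * lin odeOneA odeOneB (u t) (v t) * ((derivU u)^[0] W) t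
        + wH7.eval (u t) * lin odeOneA odeOneB (u t) (v t) * ((derivU u)^[1] W) t
        + wH7.eval (u t) ^ 2 * cH7.eval (u t) * fH7.eval (u t) *
          lin odeTwoA odeTwoB (u t) (v t) * ((derivU u)^[2] W) t
        + wH7.eval (u t) ^ 3 * cH7.eval (u t) ^ 2 * qH7.eval (u t) * fH7.eval (u t) ^ 2 *
          ((derivU u)^[3] W) t := by
      funext t
      exact sum_odeCoeff (u t) (v t) fun k => ((derivU u)^[k] W) t
    rw [hE']
    exact ((((hl _ _).const_mul _).mul (hd 0)).add (((hev _).mul (hl _ _)).mul (hd 1))).add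
      ((((((hev _).pow 2).mul (hev _)).mul (hev _)).mul (hl _ _)).mul (hd 2)) |>.add
      ((((((hev _).pow 3).mul ((hev _).pow 2)).mul (hev _)).mul ((hev _).pow 2)).mul (hd 3))
  -- The identity theorem: `E` is analytic on the preconnected `Ω` and vanishes near `t₀`.
  obtain ⟨t₀, ht₀⟩ := hne
  exact (hdiff.analyticOnNhd hp.isOpen).eqOn_zero_of_preconnected_of_eventuallyEq_zero
    hp.isPreconnected (hVΩ ht₀) (Filter.eventuallyEq_of_mem (hV.mem_nhds ht₀) h)

/-- The normalized form of the equation at a point. -/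
theorem IsGenericH7.satisfiesODE {V : Set ℂ} {u v W W₁ W₂ W₃ : ℂ → ℂ} (hG : IsGenericH7 V u v)
    (h₁ : HasDerivU u V W W₁) (h₂ : HasDerivU u V W₁ W₂) (h₃ : HasDerivU u V W₂ W₃)
    (h : ∀ t ∈ V, W₃ t
      + lin odeTwoA odeTwoB (u t) (v t) /
          (wH7.eval (u t) * cH7.eval (u t) * qH7.eval (u t) * v t ^ 2) * W₂ t
      + lin odeOneA odeOneB (u t) (v t) /
          (wH7.eval (u t) ^ 3 * cH7.eval (u t) ^ 2 * qH7.eval (u t) * v t ^ 4) *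
        (wH7.eval (u t) * W₁ t - 4 * W t) = 0) : SatisfiesODE odeCoeff V u v W := by
  intro t ht
  have e₁ : ∀ t ∈ V, ((derivU u)^[1] W) t = W₁ t := h₁.derivU_eq hG.deriv_ne_zero
  have e₂ : ∀ t ∈ V, ((derivU u)^[2] W) t = W₂ t := fun t ht => by
    rw [Function.iterate_succ_apply']
    exact (h₂.congr_fun hG.isOpen e₁).derivU_eq hG.deriv_ne_zero t ht
  have e₃ : ((derivU u)^[3] W) t = W₃ t := by
    rw [Function.iterate_succ_apply']
    exact (h₃.congr_fun hG.isOpen e₂).derivU_eq hG.deriv_ne_zero t ht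
  have key := sum_odeCoeff (u t) (v t) fun k => ((derivU u)^[k] W) t
  rw [e₁ t ht, e₂ t ht, e₃, ← hG.sq_eq t ht] at key
  refine key.trans ?_
  have h0 := h t ht
  have hv := hG.v_ne t ht
  have hw := hG.w_ne t ht
  have hq := hG.q_ne t ht
  have hc := hG.c_ne t ht
  simp only [Function.iterate_zero, id_eq]
  field_simp at h0
  linear_combination h0

/-- Three derivatives of `M F₀`, with `M' = m M` and `Fₖ' = l Fₖ₊₁`. -/
theorem HasLogDerivU.derivatives {u : ℂ → ℂ} {V : Set ℂ} {M m m₁ m₂ l l₁ l₂ F₀ F₁ F₂ F₃ : ℂ → ℂ}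
    (hM : HasLogDerivU u V M m) (hm : HasDerivU u V m m₁) (hm₁ : HasDerivU u V m₁ m₂)
    (hl : HasDerivU u V l l₁) (hl₁ : HasDerivU u V l₁ l₂)
    (h₀ : HasDerivU u V F₀ fun t => l t * F₁ t) (h₁ : HasDerivU u V F₁ fun t => l t * F₂ t)
    (h₂ : HasDerivU u V F₂ fun t => l t * F₃ t) :
    HasDerivU u V (fun t => M t * F₀ t) (fun t => M t * (m t * F₀ t + l t * F₁ t)) ∧
    HasDerivU u V (fun t => M t * (m t * F₀ t + l t * F₁ t))
      (fun t => M t * ((m₁ t + m t * m t) * F₀ t + (2 * (m t * l t) + l₁ t) * F₁ t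
        + l t * l t * F₂ t)) ∧
    HasDerivU u V
      (fun t => M t * ((m₁ t + m t * m t) * F₀ t + (2 * (m t * l t) + l₁ t) * F₁ t
        + l t * l t * F₂ t))
      (fun t => M t * ((m₂ t + 3 * m t * m₁ t + m t ^ 3) * F₀ t
        + (3 * m t ^ 2 * l t + 3 * m₁ t * l t + 3 * m t * l₁ t + l₂ t) * F₁ t
        + (3 * m t * l t ^ 2 + 3 * l t * l₁ t) * F₂ t + l t ^ 3 * F₃ t)) := by
  refine ⟨(HasDerivU.mul hM h₀).congr_deriv fun t _ => by ring,
    (HasDerivU.mul hM ((hm.mul h₀).add (hl.mul h₁))).congr_deriv fun t _ => by ring,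
    (HasDerivU.mul hM ((((hm₁.add (hm.mul hm)).mul h₀).add
      ((((hm.mul hl).const_mul 2).add hl₁).mul h₁)).add ((hl.mul hl).mul h₂))).congr_deriv
      fun t _ => by ring⟩

namespace IsGenericH7

variable {V : Set ℂ} {u v : ℂ → ℂ}

/-- The logarithmic derivative of `A(u) + v B(u)` from a polynomial identity on the curve. -/
theorem hasLogDerivU_lin (hG : IsGenericH7 V u v) {e A B N M : ℂ[X]}
    (he : ∀ t ∈ V, e.eval (u t) ≠ 0)
    (hid : ∀ x y : ℂ, y ^ 2 = fH7.eval x →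
      2 * (lin A B x y * lin N M x y) =
        e.eval x * y * (2 * y * lin A.derivative B.derivative x y
          + fH7.derivative.eval x * B.eval x)) :
    HasLogDerivU u V (fun t => lin A B (u t) (v t))
      fun t => lin N M (u t) (v t) / (e.eval (u t) * v t ^ 2) :=
  (hG.hasDerivU_lin A B).hasLogDerivU fun t ht => by
    have h1 := he t ht
    have h2 := hG.v_ne t ht
    have h3 := hid (u t) (v t) (hG.sq_eq t ht)
    field_simp
    linear_combination -h3

theorem wc_ne (hG : IsGenericH7 V u v) : ∀ t ∈ V, (wH7 * cH7).eval (u t) ≠ 0 := fun t ht => by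
  rw [eval_mul]
  exact mul_ne_zero (hG.w_ne t ht) (hG.c_ne t ht)

theorem wh_ne (hG : IsGenericH7 V u v) : ∀ t ∈ V, (wH7 * hH7).eval (u t) ≠ 0 := fun t ht => by
  rw [eval_mul]
  exact mul_ne_zero (hG.w_ne t ht) (hG.h_ne t ht)

theorem pSeven_ne (hG : IsGenericH7 V u v) :
    ∀ t ∈ V, lin pSevenA pSevenB (u t) (v t) ≠ 0 := fun t ht h0 => by
  have h := pSeven_mul_conj (u t) (v t) (hG.sq_eq t ht)
  rw [h0, zero_mul, eq_comm] at h
  exact mul_ne_zero (mul_ne_zero one_ne_zero (hG.u_ne t ht)) (pow_ne_zero 7 (hG.w_ne t ht)) h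

theorem facPos_mul_facNeg_ne (hG : IsGenericH7 V u v) : ∀ t ∈ V,
    lin facPosA facPosB (u t) (v t) * lin facNegA facNegB (u t) (v t) ≠ 0 := fun t ht => by
  rw [facPos_mul_facNeg (u t) (v t) (hG.sq_eq t ht)]
  exact mul_ne_zero (mul_ne_zero (mul_ne_zero (by norm_num) (hG.u_ne t ht)) (hG.w_ne t ht))
    (hG.c_ne t ht)

end IsGenericH7

/-! ### The hypergeometric solution. -/

theorem polyP7_eq_lin (x y : ℂ) : polyP7 x y = lin pSevenA pSevenB x y := by
  simp only [polyP7, lin, pSevenA, pSevenB, eval_ofCoeffs_cons, eval_ofCoeffs_nil]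
  ring

theorem facPos_eq_lin (x y : ℂ) : 2 * y - 3 * x + 14 * x ^ 2 = lin facPosA facPosB x y := by
  simp only [lin, facPosA, facPosB, eval_ofCoeffs_cons, eval_ofCoeffs_nil]
  ring

theorem facNeg_eq_lin (x y : ℂ) : -2 * y - 3 * x + 14 * x ^ 2 = lin facNegA facNegB x y := by
  simp only [lin, facNegA, facNegB, eval_ofCoeffs_cons, eval_ofCoeffs_nil]
  ring

theorem one_sub_eq_wH7 (x : ℂ) : 1 - 4 * x = -1 * wH7.eval x := by
  simp only [wH7, eval_ofCoeffs_cons, eval_ofCoeffs_nil]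
  ring

theorem HasLogDerivU.const_mul {u : ℂ → ℂ} {V : Set ℂ} {f κ : ℂ → ℂ} (hf : HasLogDerivU u V f κ)
    (c : ℂ) : HasLogDerivU u V (fun t => c * f t) κ :=
  (HasDerivU.const_mul c hf).congr_deriv fun _ _ => (mul_assoc _ _ _).symm

theorem IsGenericH7.hasLogDerivU_psi7 {V : Set ℂ} {u v : ℂ → ℂ} (hG : IsGenericH7 V u v) :
    HasLogDerivU u V (fun t => psi7 (u t) (v t))
      fun t => lin ellA 0 (u t) (v t) / (cH7.eval (u t) ^ 1 * v t ^ 1) := by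
  have hX := hG.hasLogDerivU_eval X (by simpa using hG.u_ne)
  simp only [eval_X, derivative_X, eval_one] at hX
  have hP := hG.hasLogDerivU_lin hG.w_ne log_pSeven
  have hF := hG.hasLogDerivU_lin hG.wc_ne log_facPos
  have hN := hG.hasLogDerivU_lin hG.wc_ne log_facNeg
  have hw := (hG.hasLogDerivU_eval wH7 hG.w_ne).const_mul (-1)
  have h := ((hP.pow 2).mul (hF.pow 7)).div ((hX.mul (hw.pow 7)).mul (hN.pow 7)) fun t ht =>
    mul_ne_zero (mul_ne_zero (hG.u_ne t ht)
      (pow_ne_zero 7 (mul_ne_zero (neg_ne_zero.2 one_ne_zero) (hG.w_ne t ht))))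
      (pow_ne_zero 7 (right_ne_zero_of_mul (hG.facPos_mul_facNeg_ne t ht)))
  simp only [psi7, denPsi7, polyP7_eq_lin, facPos_eq_lin, facNeg_eq_lin, one_sub_eq_wH7]
  refine h.congr_log fun t ht => ?_
  have hu := hG.u_ne t ht
  have hv := hG.v_ne t ht
  have hw := hG.w_ne t ht
  have hc := hG.c_ne t ht
  have key := log_psi (u t) (v t) (hG.sq_eq t ht)
  have hdw : wH7.derivative.eval (u t) = 4 := by
    simp only [wH7, eval_derivative_ofCoeffs_cons, eval_derivative_ofCoeffs_nil,
      eval_ofCoeffs_cons, eval_ofCoeffs_nil]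
    ring
  have hf₀ : f₀H7.eval (u t) = v t ^ 2 / u t := by
    rw [hG.sq_eq t ht, fH7_eq, mul_div_cancel_left₀ _ hu]
  rw [hf₀] at key
  simp only [hdw, eval_mul, Nat.cast_ofNat]
  field_simp at key ⊢
  linear_combination key

theorem IsGenericH7.hasLogDerivU_prefactor {V : Set ℂ} {u v s p r : ℂ → ℂ}
    (hG : IsGenericH7 V u v)
    (hs : IsRootBranch 2 V (fun t => 2 * v t + 3 * u t - 14 * u t ^ 2) s)
    (hp : IsRootBranch 14 V (fun t => polyP7 (u t) (v t)) p) (hr : IsRootBranch 7 V u r) :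
    HasLogDerivU u V (fun t => s t * p t * r t ^ (-2 : ℤ))
      fun t => lin prefA prefB (u t) (v t) / ((wH7 * cH7).eval (u t) ^ 1 * v t ^ 1) := by
  have hX := hG.hasLogDerivU_eval X (by simpa using hG.u_ne)
  simp only [eval_X, derivative_X, eval_one] at hX
  have hP := hG.hasLogDerivU_lin hG.w_ne log_pSeven
  have hN := (hG.hasLogDerivU_lin hG.wc_ne log_facNeg).const_mul (-1)
  have es : (fun t => 2 * v t + 3 * u t - 14 * u t ^ 2) =
      fun t => -1 * lin facNegA facNegB (u t) (v t) := by
    funext t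
    rw [← facNeg_eq_lin]
    ring
  rw [es] at hs
  simp only [polyP7_eq_lin] at hp
  have ls := HasLogDerivU.of_isRootBranch two_ne_zero hG.isOpen hs hN fun t ht =>
    mul_ne_zero (neg_ne_zero.2 one_ne_zero) (right_ne_zero_of_mul (hG.facPos_mul_facNeg_ne t ht))
  have lp := HasLogDerivU.of_isRootBranch (by norm_num) hG.isOpen hp hP hG.pSeven_ne
  have lr := HasLogDerivU.of_isRootBranch (by norm_num) hG.isOpen hr hX hG.u_ne
  have hr0 : ∀ t ∈ V, r t ≠ 0 := fun t ht h0 => hG.u_ne t ht (by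
    rw [← hr.2 t ht, h0, zero_pow (by norm_num)])
  have h := (ls.mul lp).mul ((lr.pow 2).inv fun t ht => pow_ne_zero 2 (hr0 t ht))
  simp only [zpow_neg, zpow_ofNat]
  refine h.congr_log fun t ht => ?_
  have hu := hG.u_ne t ht
  have hv := hG.v_ne t ht
  have hw := hG.w_ne t ht
  have hc := hG.c_ne t ht
  have key := log_prefactor (u t) (v t) (hG.sq_eq t ht)
  have hf₀ : f₀H7.eval (u t) = v t ^ 2 / u t := by
    rw [hG.sq_eq t ht, fH7_eq, mul_div_cancel_left₀ _ hu]
  rw [hf₀] at key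
  simp only [eval_mul, Nat.cast_ofNat]
  field_simp at key ⊢
  linear_combination key

theorem IsGenericH7.quo_mul_one_sub_psi7 {V : Set ℂ} {u v : ℂ → ℂ} (hG : IsGenericH7 V u v) {t : ℂ}
    (ht : t ∈ V) :
    lin quoA quoB (u t) (v t) / (cH7.eval (u t) ^ 2 * qH7.eval (u t) * v t ^ 2) *
      (1 - psi7 (u t) (v t)) =
    (lin ellA 0 (u t) (v t) / (cH7.eval (u t) ^ 1 * v t ^ 1)) ^ 2 := by
  have hu := hG.u_ne t ht
  have hv := hG.v_ne t ht
  have hw := hG.w_ne t ht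
  have hc := hG.c_ne t ht
  have hq := hG.q_ne t ht
  have hN := right_ne_zero_of_mul (hG.facPos_mul_facNeg_ne t ht)
  have key := quo_identity (u t) (v t) (hG.sq_eq t ht)
  rw [← facPos_pow _ _ (hG.sq_eq t ht), ← facNeg_pow _ _ (hG.sq_eq t ht), one_sub_eq_wH7] at key
  simp only [psi7, denPsi7, polyP7_eq_lin, facPos_eq_lin, facNeg_eq_lin, one_sub_eq_wH7]
  generalize lin quoA quoB (u t) (v t) = T at *
  generalize lin ellA 0 (u t) (v t) = l at *
  generalize lin pSevenA pSevenB (u t) (v t) = P at *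
  generalize lin facPosA facPosB (u t) (v t) = A at *
  generalize lin facNegA facNegB (u t) (v t) = B at *
  field_simp
  linear_combination -key

theorem IsGenericH7.psi7_ne_zero {V : Set ℂ} {u v : ℂ → ℂ} (hG : IsGenericH7 V u v) :
    ∀ t ∈ V, psi7 (u t) (v t) ≠ 0 := fun t ht => by
  have hF := left_ne_zero_of_mul (hG.facPos_mul_facNeg_ne t ht)
  have hN := right_ne_zero_of_mul (hG.facPos_mul_facNeg_ne t ht)
  have hP := hG.pSeven_ne t ht
  have hw := hG.w_ne t ht
  have hu := hG.u_ne t ht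
  simp only [psi7, denPsi7, polyP7_eq_lin, facPos_eq_lin, facNeg_eq_lin, one_sub_eq_wH7]
  exact div_ne_zero (mul_ne_zero (pow_ne_zero _ hP) (pow_ne_zero _ hF)) (mul_ne_zero
    (mul_ne_zero hu (pow_ne_zero _ (mul_ne_zero (neg_ne_zero.2 one_ne_zero) hw)))
    (pow_ne_zero _ hN))

/-- Chain rule: `(d/du) Fₖ(Ψ) = (Fₖ₊₁(Ψ)/Ψ) Ψ' = ℓ Fₖ₊₁(Ψ)`. The factor `Ψ` cancels, since it is
nonzero on a generic set. -/
theorem IsGenericH7.hasDerivU_eulerSeries {V : Set ℂ} {u v : ℂ → ℂ} (hG : IsGenericH7 V u v)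
    (h1 : ∀ t ∈ V, ‖psi7 (u t) (v t)‖ < 1) (k : ℕ) :
    HasDerivU u V (fun t => eulerSeries hypCoeff k (psi7 (u t) (v t)))
      fun t => lin ellA 0 (u t) (v t) / (cH7.eval (u t) ^ 1 * v t ^ 1) *
        eulerSeries hypCoeff (k + 1) (psi7 (u t) (v t)) :=
  (HasDerivU.comp hG.hasLogDerivU_psi7 fun t ht => hasDerivAt_eulerSeries norm_hypCoeff_le k
    (h1 t ht) (hG.psi7_ne_zero t ht)).congr_deriv fun t ht => by
      rw [← mul_assoc, div_mul_cancel₀ _ (hG.psi7_ne_zero t ht), mul_comm]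

/-- The hypergeometric branch satisfies the equation on a generic set. -/
theorem IsGenericH7.satisfiesODE_hypergeometric {V : Set ℂ} {u v W s p r : ℂ → ℂ}
    (hG : IsGenericH7 V u v)
    (hs : IsRootBranch 2 V (fun t => 2 * v t + 3 * u t - 14 * u t ^ 2) s)
    (hp : IsRootBranch 14 V (fun t => polyP7 (u t) (v t)) p) (hr : IsRootBranch 7 V u r)
    (h1 : ∀ t ∈ V, ‖psi7 (u t) (v t)‖ < 1)
    (hW : ∀ t ∈ V, W t = s t * p t * r t ^ (-2 : ℤ) *
      hyp3F2 (-1 / 14) (1 / 14) (5 / 14) (1 / 7) (5 / 7) (psi7 (u t) (v t))) :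
    SatisfiesODE odeCoeff V u v W := by
  have hF := hG.hasDerivU_eulerSeries h1
  obtain ⟨d₁, d₂, d₃⟩ := (hG.hasLogDerivU_prefactor hs hp hr).derivatives
    (hG.hasDerivU_div 1 1 hG.wc_ne deriv_pref) (hG.hasDerivU_div 2 3 hG.wc_ne deriv_pref₁)
    (hG.hasDerivU_div 1 1 hG.c_ne deriv_ell) (hG.hasDerivU_div 2 3 hG.c_ne deriv_ell₁)
    (hF 0) (hF 1) (hF 2)
  have hW' : ∀ t ∈ V, W t = s t * p t * r t ^ (-2 : ℤ) *
      eulerSeries hypCoeff 0 (psi7 (u t) (v t)) := fun t ht => by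
    rw [hW t ht, hyp3F2_eq_eulerSeries]
  refine hG.satisfiesODE (d₁.congr_fun hG.isOpen hW') d₂ d₃ fun t ht => ?_
  rw [hW' t ht]
  have hT := hG.quo_mul_one_sub_psi7 ht
  have hyp := eulerSeries_hypCoeff_ode (h1 t ht)
  have i₂ := ode_pref_two (u t) (v t) (hG.sq_eq t ht)
  have i₁ := ode_pref_one (u t) (v t) (hG.sq_eq t ht)
  have i₀ := ode_pref_zero (u t) (v t) (hG.sq_eq t ht)
  have hv := hG.v_ne t ht
  have hw := hG.w_ne t ht
  have hc := hG.c_ne t ht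
  have hq := hG.q_ne t ht
  simp only [eval_mul, Nat.reduceAdd, zero_add] at *
  -- All that remains is algebra in the values at `t`. Naming them keeps the large polynomials out
  -- of `field_simp` and `linear_combination`.
  generalize s t * p t * r t ^ (-2 : ℤ) = M
  generalize psi7 (u t) (v t) = z at *
  generalize eulerSeries hypCoeff 0 z = F₀ at *
  generalize eulerSeries hypCoeff 1 z = F₁ at *
  generalize eulerSeries hypCoeff 2 z = F₂ at *
  generalize eulerSeries hypCoeff 3 z = F₃ at *
  generalize lin odeTwoA odeTwoB (u t) (v t) = b₂ at *
  generalize lin odeOneA odeOneB (u t) (v t) = b₁ at *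
  generalize lin quoA quoB (u t) (v t) = T at *
  generalize lin prefA prefB (u t) (v t) = m at *
  generalize lin pref₁A pref₁B (u t) (v t) = m₁ at *
  generalize lin pref₂A pref₂B (u t) (v t) = m₂ at *
  generalize lin ellA 0 (u t) (v t) = l at *
  generalize lin ell₁A 0 (u t) (v t) = l₁ at *
  generalize lin ell₂A 0 (u t) (v t) = l₂ at *
  generalize wH7.eval (u t) = w at *
  generalize cH7.eval (u t) = c at *
  generalize qH7.eval (u t) = q at *
  generalize v t = y at *
  have e₂ : 3 * (m / ((w * c) ^ 1 * y ^ 1)) * (l / (c ^ 1 * y ^ 1))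
      + 3 * (l₁ / (c ^ 2 * y ^ 3)) + 3 / 2 * (T / (c ^ 2 * q * y ^ 2))
      - 5 / 14 * (l / (c ^ 1 * y ^ 1)) ^ 2
      + b₂ / (w * c * q * y ^ 2) * (l / (c ^ 1 * y ^ 1)) = 0 := by
    field_simp
    linear_combination 28 * i₂
  have e₁ : 3 * (m / ((w * c) ^ 1 * y ^ 1)) ^ 2 * (l / (c ^ 1 * y ^ 1))
      + 3 * (m₁ / ((w * c) ^ 2 * y ^ 3)) * (l / (c ^ 1 * y ^ 1))
      + 3 * (m / ((w * c) ^ 1 * y ^ 1)) * (l₁ / (c ^ 2 * y ^ 3)) + l₂ / (c ^ 3 * y ^ 5)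
      - 1 / 4 * (l / (c ^ 1 * y ^ 1)) * (T / (c ^ 2 * q * y ^ 2))
      + 1 / 196 * (l / (c ^ 1 * y ^ 1)) ^ 3
      + b₂ / (w * c * q * y ^ 2) * (2 * (m / ((w * c) ^ 1 * y ^ 1) * (l / (c ^ 1 * y ^ 1)))
        + l₁ / (c ^ 2 * y ^ 3))
      + b₁ / (w ^ 3 * c ^ 2 * q * y ^ 4) * (w * (l / (c ^ 1 * y ^ 1))) = 0 := by
    field_simp
    linear_combination 784 * i₁
  have e₀ : m₂ / ((w * c) ^ 3 * y ^ 5)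
      + 3 * (m / ((w * c) ^ 1 * y ^ 1)) * (m₁ / ((w * c) ^ 2 * y ^ 3))
      + (m / ((w * c) ^ 1 * y ^ 1)) ^ 3
      + b₂ / (w * c * q * y ^ 2) * (m₁ / ((w * c) ^ 2 * y ^ 3)
        + m / ((w * c) ^ 1 * y ^ 1) * (m / ((w * c) ^ 1 * y ^ 1)))
      + b₁ / (w ^ 3 * c ^ 2 * q * y ^ 4) * (w * (m / ((w * c) ^ 1 * y ^ 1)) - 4)
      - 5 / 2744 * (l / (c ^ 1 * y ^ 1)) * (T / (c ^ 2 * q * y ^ 2)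
        - (l / (c ^ 1 * y ^ 1)) ^ 2) = 0 := by
    field_simp
    linear_combination 2744 * i₀
  generalize T / (c ^ 2 * q * y ^ 2) = T at *
  generalize l / (c ^ 1 * y ^ 1) = l at *
  -- `hyp`, multiplied by `MℓT`, removes `F₃`; the multiples of `hT` replace `T(1 - z)` by `ℓ²`,
  -- both in front of `F₃` and in the terms with `zT`.
  linear_combination M * F₀ * e₀ + M * F₁ * e₁ + M * F₂ * l * e₂ + M * l * T * hyp
    - M * l * F₃ * hT - M * l * (5 / 14 * F₂ - 1 / 196 * F₁ - 5 / 2744 * F₀) * hT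

/-! ### The radical solutions. -/

theorem polyP1_eq_lin (x y : ℂ) : polyP1 x y = lin polyP1A polyP1B x y := by
  simp only [polyP1, lin, polyP1A, polyP1B, eval_ofCoeffs_cons, eval_ofCoeffs_nil]
  ring

theorem polyQ1_eq_lin (x y : ℂ) : polyQ1 x y = lin polyQ1A polyQ1B x y := by
  simp only [polyQ1, lin, polyQ1A, polyQ1B, eval_ofCoeffs_cons, eval_ofCoeffs_nil]
  ring

/-- The radical branches satisfy the equation on a generic set. -/
theorem IsGenericH7.satisfiesODE_radical {V : Set ℂ} {u v W g : ℂ → ℂ} (hG : IsGenericH7 V u v)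
    (hg : IsRootBranch 2 V (fun t => 56 * u t - 21 + 2 / u t) g)
    (hW : IsRootBranch 4 V (fun t => polyP1 (u t) (v t) + polyQ1 (u t) (v t) * g t) W) :
    SatisfiesODE odeCoeff V u v W := by
  have hg2 : ∀ t ∈ V, u t * g t ^ 2 = qH7.eval (u t) := fun t ht => by
    have hu := hG.u_ne t ht
    rw [hg.2 t ht]
    simp only [qH7, eval_ofCoeffs_cons, eval_ofCoeffs_nil]
    field_simp
    ring
  have hg0 : ∀ t ∈ V, g t ≠ 0 := fun t ht h0 => hG.q_ne t ht (by
    rw [← hg2 t ht, h0]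
    ring)
  have hu' : DifferentiableOn ℂ u V := fun t ht =>
    (hG.hasDerivU_u t ht).differentiableAt.differentiableWithinAt
  -- `y = u g` replaces `g` because its square `u q` is a polynomial in `u`.
  have hy : DifferentiableOn ℂ (fun t => u t * g t) V := hu'.mul hg.1
  have hy2 : ∀ t ∈ V, (u t * g t) ^ 2 = u t * qH7.eval (u t) := fun t ht => by
    rw [← hg2 t ht]
    ring
  have lX := hG.hasLogDerivU_eval X (by simpa using hG.u_ne)
  simp only [eval_X, derivative_X, eval_one] at lX
  have lg : HasLogDerivU u V g fun t =>
      (qH7.derivative.eval (u t) / qH7.eval (u t) - 1 / u t) / 2 := by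
    refine (((hG.hasLogDerivU_sqrt hy hy2).div lX hG.u_ne).congr_fun hG.isOpen
      fun t ht => ?_).congr_log fun t ht => ?_
    · rw [mul_div_cancel_left₀ _ (hG.u_ne t ht)]
    · ring
  have hX := (hG.hasDerivU_lin polyP1A polyP1B).add ((hG.hasDerivU_lin polyQ1A polyQ1B).mul lg)
  set lam : ℂ → ℂ := fun t =>
    lin lamA lamB (u t) (v t) / ((wH7 * hH7).eval (u t) ^ 1 * v t ^ 1)
    + lin muA muB (u t) (v t) / ((wH7 * hH7).eval (u t) ^ 1 * qH7.eval (u t) ^ 0 * v t ^ 1 *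
        (u t * g t)) with hlam
  simp only [polyP1_eq_lin, polyQ1_eq_lin] at hW
  have lX : HasLogDerivU u V
      (fun t => lin polyP1A polyP1B (u t) (v t) + lin polyQ1A polyQ1B (u t) (v t) * g t)
      fun t => 4 * lam t := hX.hasLogDerivU fun t ht => by
    have i₁ := log_W_one (u t) (v t) (hG.sq_eq t ht)
    have i₂ := log_W_sqrt (u t) (v t) (hG.sq_eq t ht)
    have hv := hG.v_ne t ht
    have hw := hG.w_ne t ht
    have hh := hG.h_ne t ht
    have hq := hG.q_ne t ht
    have hu := hG.u_ne t ht
    have hg' := hg0 t ht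
    have hgq := hg2 t ht
    rw [← hgq] at hq i₂
    simp only [hlam, eval_mul]
    rw [← hgq]
    field_simp
    refine mul_left_cancel₀ hu ?_
    linear_combination u t * g t * i₁ + i₂
  have hX0 : ∀ t ∈ V,
      lin polyP1A polyP1B (u t) (v t) + lin polyQ1A polyQ1B (u t) (v t) * g t ≠ 0 := by
    intro t ht h0
    have i₁ := normW_eq (u t) (v t) (hG.sq_eq t ht)
    have i₂ := normW_mul_conj (u t) (v t) (hG.sq_eq t ht)
    rw [← hg2 t ht] at i₁
    have hN : lin normWA normWB (u t) (v t) = 0 := by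
      refine mul_left_cancel₀ (hG.u_ne t ht) ?_
      rw [← i₁]
      -- The radicand times its conjugate under `g ↦ -g` is the product `W₊⁴ W₋⁴`, so a zero of the
      -- radicand is a zero of that product.
      linear_combination u t * (lin polyP1A polyP1B (u t) (v t)
        - lin polyQ1A polyQ1B (u t) (v t) * g t) * h0
    rw [hN, zero_mul, eq_comm] at i₂
    exact mul_ne_zero (mul_ne_zero (by norm_num) (pow_ne_zero 12 (hG.w_ne t ht)))
      (pow_ne_zero 4 (hG.h_ne t ht)) i₂
  have lW : HasLogDerivU u V W lam :=
    (HasLogDerivU.of_isRootBranch four_ne_zero hG.isOpen hW lX hX0).congr_log fun t _ => by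
      push_cast
      ring
  -- `W` is treated as `M · 1`: in `HasLogDerivU.derivatives` one takes `ℓ = 0` and every `Fₖ = 1`.
  have h0 : HasDerivU u V (fun _ => 0) fun _ => 0 := HasDerivU.const 0
  have h1 : HasDerivU u V (fun _ => 1) fun t => (fun _ => 0 : ℂ → ℂ) t * (fun _ => 1 : ℂ → ℂ) t :=
    (HasDerivU.const 1).congr_deriv fun _ _ => (zero_mul _).symm
  obtain ⟨d₁, d₂, d₃⟩ := lW.derivatives
    ((hG.hasDerivU_div 1 1 hG.wh_ne deriv_lam).add
      (hG.hasDerivU_div_sqrt hy hy2 1 0 1 hG.wh_ne deriv_mu))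
    ((hG.hasDerivU_div 2 3 hG.wh_ne deriv_lam₁).add
      (hG.hasDerivU_div_sqrt hy hy2 2 1 3 hG.wh_ne deriv_mu₁)) h0 h0 h1 h1 h1
  refine hG.satisfiesODE (d₁.congr_fun hG.isOpen fun t _ => (mul_one _).symm) d₂ d₃ fun t ht => ?_
  have i₁ := ode_lam_one (u t) (v t) (hG.sq_eq t ht)
  have i₂ := ode_lam_sqrt (u t) (v t) (hG.sq_eq t ht)
  have hr : (u t * g t)⁻¹ ^ 2 = 1 / (u t * qH7.eval (u t)) := by
    rw [inv_pow, hy2 t ht, one_div]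
  have hv := hG.v_ne t ht
  have hw := hG.w_ne t ht
  have hh := hG.h_ne t ht
  have hq := hG.q_ne t ht
  have hu := hG.u_ne t ht
  have hc := hG.c_ne t ht
  simp only [hlam, eval_mul, div_mul_eq_div_mul_one_div _ _ (u t * g t), one_div (u t * g t),
    Nat.reduceAdd]
  -- Of `r = 1/y` only `r² = 1/(u q)` is used, so the equation reduces to its parts of degree 0 and
  -- 1 in `r`, which are `e₁` and `e₂`.
  generalize (u t * g t)⁻¹ = r at *
  generalize W t = M at *
  generalize lin odeTwoA odeTwoB (u t) (v t) = b₂ at *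
  generalize lin odeOneA odeOneB (u t) (v t) = b₁ at *
  generalize lin lamA lamB (u t) (v t) = a at *
  generalize lin lam₁A lam₁B (u t) (v t) = a₁ at *
  generalize lin lam₂A lam₂B (u t) (v t) = a₂ at *
  generalize lin muA muB (u t) (v t) = m at *
  generalize lin mu₁A mu₁B (u t) (v t) = m₁ at *
  generalize lin mu₂A mu₂B (u t) (v t) = m₂ at *
  generalize wH7.eval (u t) = w at *
  generalize cH7.eval (u t) = c at *
  generalize qH7.eval (u t) = q at *
  generalize hH7.eval (u t) = h at *
  generalize u t = x at *
  generalize v t = y at *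
  have e₁ : a₂ / ((w * h) ^ 3 * y ^ 5)
      + 3 * (a / ((w * h) ^ 1 * y ^ 1) * (a₁ / ((w * h) ^ 2 * y ^ 3))
        + m / ((w * h) ^ 1 * q ^ 0 * y ^ 1) * (m₁ / ((w * h) ^ 2 * q ^ 1 * y ^ 3))
          * (1 / (x * q)))
      + (a / ((w * h) ^ 1 * y ^ 1)) ^ 3
      + 3 * (a / ((w * h) ^ 1 * y ^ 1)) * (m / ((w * h) ^ 1 * q ^ 0 * y ^ 1)) ^ 2 * (1 / (x * q))
      + b₂ / (w * c * q * y ^ 2) * (a₁ / ((w * h) ^ 2 * y ^ 3) + (a / ((w * h) ^ 1 * y ^ 1)) ^ 2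
        + (m / ((w * h) ^ 1 * q ^ 0 * y ^ 1)) ^ 2 * (1 / (x * q)))
      + b₁ / (w ^ 3 * c ^ 2 * q * y ^ 4) * (w * (a / ((w * h) ^ 1 * y ^ 1)) - 4) = 0 := by
    field_simp
    linear_combination i₁
  have e₂ : m₂ / ((w * h) ^ 3 * q ^ 2 * y ^ 5)
      + 3 * (a / ((w * h) ^ 1 * y ^ 1) * (m₁ / ((w * h) ^ 2 * q ^ 1 * y ^ 3))
        + m / ((w * h) ^ 1 * q ^ 0 * y ^ 1) * (a₁ / ((w * h) ^ 2 * y ^ 3)))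
      + 3 * (a / ((w * h) ^ 1 * y ^ 1)) ^ 2 * (m / ((w * h) ^ 1 * q ^ 0 * y ^ 1))
      + (m / ((w * h) ^ 1 * q ^ 0 * y ^ 1)) ^ 3 * (1 / (x * q))
      + b₂ / (w * c * q * y ^ 2) * (m₁ / ((w * h) ^ 2 * q ^ 1 * y ^ 3)
        + 2 * (a / ((w * h) ^ 1 * y ^ 1)) * (m / ((w * h) ^ 1 * q ^ 0 * y ^ 1)))
      + b₁ / (w ^ 3 * c ^ 2 * q * y ^ 4) * (w * (m / ((w * h) ^ 1 * q ^ 0 * y ^ 1))) = 0 := by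
    field_simp
    linear_combination i₂
  generalize a / ((w * h) ^ 1 * y ^ 1) = a at *
  generalize a₁ / ((w * h) ^ 2 * y ^ 3) = a₁ at *
  generalize a₂ / ((w * h) ^ 3 * y ^ 5) = a₂ at *
  generalize m / ((w * h) ^ 1 * q ^ 0 * y ^ 1) = m at *
  generalize m₁ / ((w * h) ^ 2 * q ^ 1 * y ^ 3) = m₁ at *
  generalize m₂ / ((w * h) ^ 3 * q ^ 2 * y ^ 5) = m₂ at *
  generalize b₂ / (w * c * q * y ^ 2) = b₂ at *
  linear_combination M * e₁ + M * r * e₂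
    + M * (3 * m * m₁ + 3 * a * m ^ 2 + m ^ 3 * r + b₂ * m ^ 2) * hr

/-! ### The linear solution, and passage from generic sets to arbitrary branches. -/

theorem satisfiesODE_linear {Ω : Set ℂ} {u v : ℂ → ℂ} (hp : IsParamH7 Ω u v) :
    SatisfiesODE odeCoeff Ω u v fun t => 4 * u t - 1 := by
  have hu : HasDerivU u Ω u fun _ => 1 := hasDerivU_self fun t ht =>
    differentiableAt_of_deriv_ne_zero (hp.deriv_ne_zero t ht)
  have d₁ : HasDerivU u Ω (fun t => 4 * u t - 1) fun _ => 4 := by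
    simpa only [sub_eq_add_neg, mul_one, add_zero] using (hu.const_mul 4).add (HasDerivU.const (-1))
  have e₁ : ∀ t ∈ Ω, ((derivU u)^[1] fun t => 4 * u t - 1) t = 4 := d₁.derivU_eq hp.deriv_ne_zero
  have e₂ : ∀ t ∈ Ω, ((derivU u)^[2] fun t => 4 * u t - 1) t = 0 := fun t ht => by
    rw [Function.iterate_succ_apply']
    exact ((HasDerivU.const 4).congr_fun hp.isOpen e₁).derivU_eq hp.deriv_ne_zero t ht
  intro t ht
  have e₃ : ((derivU u)^[3] fun t => 4 * u t - 1) t = 0 := by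
    rw [Function.iterate_succ_apply']
    exact ((HasDerivU.const 0).congr_fun hp.isOpen e₂).derivU_eq hp.deriv_ne_zero t ht
  have key := sum_odeCoeff (u t) (v t) fun k => ((derivU u)^[k] fun t => 4 * u t - 1) t
  rw [e₁ t ht, e₂ t ht, e₃] at key
  refine key.trans ?_
  simp only [Function.iterate_zero, id_eq, wH7, eval_ofCoeffs_cons, eval_ofCoeffs_nil]
  ring

theorem satisfiesODE_of_isBranchW7 {Ω : Set ℂ} {u v W : ℂ → ℂ} (hp : IsParamH7 Ω u v)
    (hW : IsBranchW7 Ω u v W) : SatisfiesODE odeCoeff Ω u v W := by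
  obtain ⟨hd, V, s, p, r, hVΩ, hV, hne, hs, hP, hr, h⟩ := hW
  obtain ⟨V', hV'V, hne', hG⟩ := hp.exists_generic hV hne hVΩ
  exact satisfiesODE_of_subset hp hd hG.isOpen hne' (hV'V.trans hVΩ)
    (hG.satisfiesODE_hypergeometric (hs.mono hV'V) (hP.mono hV'V) (hr.mono hV'V)
      (fun t ht => (h t (hV'V ht)).2.1) fun t ht => (h t (hV'V ht)).2.2)

theorem satisfiesODE_of_isBranchWpm {ε : ℂ} (hε : ε ^ 2 = 1) {Ω : Set ℂ} {u v W : ℂ → ℂ}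
    (hp : IsParamH7 Ω u v) (hW : IsBranchWpm ε Ω u v W) : SatisfiesODE odeCoeff Ω u v W := by
  obtain ⟨hd, V, g, hVΩ, hV, hne, hg, h⟩ := hW
  obtain ⟨V', hV'V, hne', hG⟩ := hp.exists_generic hV hne hVΩ
  refine satisfiesODE_of_subset hp hd hG.isOpen hne' (hV'V.trans hVΩ)
    -- The sign is absorbed into the square root: `ε g` is again a branch because `ε² = 1`. Hence
    -- one computation serves both `W₊` and `W₋`.
    (hG.satisfiesODE_radical (g := fun t => ε * g t) ⟨(hg.1.mono hV'V).const_mul ε, fun t ht => ?_⟩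
      ⟨h.1.mono hV'V, fun t ht => ?_⟩)
  · rw [mul_pow, hε, one_mul, hg.2 t (hV'V ht)]
  · rw [h.2 t (hV'V ht)]
    ring

theorem mainTheorem3 :
    ∃ c : Fin 4 → Polynomial (Polynomial ℂ),
      (∃ p ∈ curveH7, (c 3).evalEval p.1 p.2 ≠ 0) ∧
      ∀ (Ω : Set ℂ) (u v : ℂ → ℂ), IsParamH7 Ω u v →
        (∀ W : ℂ → ℂ, IsBranchW7 Ω u v W → SatisfiesODE c Ω u v W) ∧
        SatisfiesODE c Ω u v (fun t => 4 * u t - 1) ∧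
        (∀ W : ℂ → ℂ, IsBranchWpm 1 Ω u v W → SatisfiesODE c Ω u v W) ∧
        (∀ W : ℂ → ℂ, IsBranchWpm (-1) Ω u v W → SatisfiesODE c Ω u v W) :=
  ⟨odeCoeff, odeCoeff_three_ne_zero, fun _ _ _ hp => ⟨fun _ => satisfiesODE_of_isBranchW7 hp,
    satisfiesODE_linear hp, fun _ => satisfiesODE_of_isBranchWpm (one_pow 2) hp,
    fun _ => satisfiesODE_of_isBranchWpm (by norm_num) hp⟩⟩
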